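/- Conventions. Let $P$ be a finite poset, with cover relation $\lessdot$, and let $m\ge 0$ be an integer. A $P$-partition of height $m$ is a weakly order-preserving map $\pi\colon P\to\{0,1,\dots,m\}$; the set of these is denoted $\mathrm{PP}^m(P)$. For $p\in P$ the piecewise-linear toggle $\tau_p\colon \mathrm{PP}^m(P)\to\mathrm{PP}^m(P)$ changes only the value at $p$, which becomes $$(\tau_p\pi)(p)=\min\{\pi(r): p\lessdot r\}+\max\{\pi(r): r\lessdot p\}-\pi(p),$$ where $\min\varnothing=m$ and $\max\varnothing=0$. Rowmotion is the bijection $\mathrm{Row}=\tau_{p_1}\circ\tau_{p_2}\circ\cdots\circ\tau_{p_N}$ of $\mathrm{PP}^m(P)$, where $p_1,\dots,p_N$ is any linear extension of $P$ (so toggles are applied from top to bottom; the result does not depend on the linear extension). The rectangle poset $a\times b$ is $\{(i,j):1\le i\le a,\ 1\le j\le b\}$ with $(i,j)\le(i',j')$ if and only if $i'\le i$ and $j'\le j$; thus $\mathrm{PP}^m(a\times b)$ is the set of $a\times b$ plane partitions with entries at most $m$. On $\mathrm{PP}^m(N\times N)$ transposition is $\mathrm{Tr}(\pi)_{i,j}=\pi_{j,i}$.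 The corner triangle $T_n$ of size $n$ (which is the root poset of type $B_n$) is the subposet $\{(i,j): 1\le i\le j,\ i+j\le 2n\}$ of the rectangle poset $2n\times 2n$. Lemma. For all integers $n,M\ge 0$ there is a bijection $$f\colon \mathrm{PP}^{M}(T_n)\longrightarrow\{\pi\in\mathrm{PP}^{2M}(2n\times 2n):\ \mathrm{Tr}(\pi)=\pi \text{ and } \mathrm{Row}^{2n}(\pi)=\pi\}$$ that is $\mathrm{Row}$-equivariant, i.e. $f(\mathrm{Row}(\pi))=\mathrm{Row}(f(\pi))$ for all $\pi\in\mathrm{PP}^M(T_n)$. -/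

import Mathlib

/-- A `P`-partition of height `m`: a weakly order-preserving map `P → {0, 1, …, m}`. -/
abbrev PPartition (P : Type*) [PartialOrder P] (m : ℕ) : Type _ := P →o Fin (m + 1)

section Toggle

variable {P : Type*} [PartialOrder P] [Fintype P] {m : ℕ}

open Classical in
/-- `min {π(r) : p ⋖ r}`, which is `m` if `p` is a maximal element. -/
noncomputable def minAbove (π : PPartition P m) (p : P) : Fin (m + 1) :=
  (Finset.univ.filter fun r : P => p ⋖ r).inf π

open Classical in
/-- `max {π(r) : r ⋖ p}`, which is `0` if `p` is a minimal element. -/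
noncomputable def maxBelow (π : PPartition P m) (p : P) : Fin (m + 1) :=
  (Finset.univ.filter fun r : P => r ⋖ p).sup π

theorem le_minAbove (π : PPartition P m) (p : P) : π p ≤ minAbove π p := by
  classical
  unfold minAbove
  refine Finset.le_inf fun r hr => π.monotone ?_
  exact (Finset.mem_filter.mp hr).2.le

theorem maxBelow_le (π : PPartition P m) (p : P) : maxBelow π p ≤ π p := by
  classical
  unfold maxBelow
  refine Finset.sup_le fun r hr => π.monotone ?_
  exact (Finset.mem_filter.mp hr).2.le

theorem minAbove_le_of_lt (π : PPartition P m) {p q : P} (h : p < q) :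
    minAbove π p ≤ π q := by
  classical
  obtain ⟨r, hr, hrq⟩ := exists_covBy_le_of_lt h
  unfold minAbove
  exact (Finset.inf_le (by simpa using hr)).trans (π.monotone hrq)

theorem le_maxBelow_of_lt (π : PPartition P m) {p q : P} (h : q < p) :
    π q ≤ maxBelow π p := by
  classical
  obtain ⟨r, hqr, hr⟩ := exists_le_covBy_of_lt h
  unfold maxBelow
  exact (π.monotone hqr).trans (Finset.le_sup (f := π) (by simpa using hr))

/-- The new value at `p`, `min {π(r) : p ⋖ r} + max {π(r) : r ⋖ p} - π(p)`. The subtraction of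
natural numbers is never truncated, because `max {π(r) : r ⋖ p} ≤ π(p) ≤ min {π(r) : p ⋖ r}`. -/
noncomputable def toggleValue (π : PPartition P m) (p : P) : Fin (m + 1) :=
  ⟨(minAbove π p : ℕ) + (maxBelow π p : ℕ) - (π p : ℕ), by
    have h1 : (maxBelow π p : ℕ) ≤ (π p : ℕ) := maxBelow_le π p
    have h2 := (minAbove π p).isLt
    omega⟩

theorem toggleValue_le (π : PPartition P m) (p : P) : toggleValue π p ≤ minAbove π p := by
  have h1 : (maxBelow π p : ℕ) ≤ (π p : ℕ) := maxBelow_le π p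
  change (minAbove π p : ℕ) + (maxBelow π p : ℕ) - (π p : ℕ) ≤ (minAbove π p : ℕ)
  omega

theorem le_toggleValue (π : PPartition P m) (p : P) : maxBelow π p ≤ toggleValue π p := by
  have h1 : (π p : ℕ) ≤ (minAbove π p : ℕ) := le_minAbove π p
  change (maxBelow π p : ℕ) ≤ (minAbove π p : ℕ) + (maxBelow π p : ℕ) - (π p : ℕ)
  omega

open Classical in
/-- The map underlying the piecewise-linear toggle at `p`. -/
noncomputable def toggleFun (p : P) (π : PPartition P m) : PPartition P m where
  toFun := fun q => if q = p then toggleValue π p else π q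
  monotone' := by
    intro a b hab
    by_cases ha : a = p <;> by_cases hb : b = p
    · simp [ha, hb]
    · subst ha
      simp only [if_true, if_neg hb]
      exact (toggleValue_le π a).trans
        (minAbove_le_of_lt π (lt_of_le_of_ne hab (fun h => hb h.symm)))
    · subst hb
      simp only [if_true, if_neg ha]
      exact (le_maxBelow_of_lt π (lt_of_le_of_ne hab ha)).trans (le_toggleValue π b)
    · simp only [if_neg ha, if_neg hb]
      exact π.monotone hab

theorem toggleFun_self (p : P) (π : PPartition P m) : toggleFun p π p = toggleValue π p :=
  if_pos rfl

theorem toggleFun_of_ne (p : P) (π : PPartition P m) {q : P} (h : q ≠ p) :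
    toggleFun p π q = π q :=
  if_neg h

theorem minAbove_congr {π σ : PPartition P m} {p : P} (h : ∀ r, p ⋖ r → π r = σ r) :
    minAbove π p = minAbove σ p := by
  classical
  unfold minAbove
  exact Finset.inf_congr rfl fun r hr => h r (Finset.mem_filter.mp hr).2

theorem maxBelow_congr {π σ : PPartition P m} {p : P} (h : ∀ r, r ⋖ p → π r = σ r) :
    maxBelow π p = maxBelow σ p := by
  classical
  unfold maxBelow
  exact Finset.sup_congr rfl fun r hr => h r (Finset.mem_filter.mp hr).2

theorem toggleFun_involutive (p : P) :
    Function.Involutive (toggleFun (m := m) p) := by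
  intro π
  ext q : 2
  by_cases h : q = p
  · subst h
    have h1 : minAbove (toggleFun q π) q = minAbove π q :=
      minAbove_congr fun r hr => toggleFun_of_ne q π hr.lt.ne'
    have h2 : maxBelow (toggleFun q π) q = maxBelow π q :=
      maxBelow_congr fun r hr => toggleFun_of_ne q π hr.lt.ne
    have h3 : (maxBelow π q : ℕ) ≤ (π q : ℕ) := maxBelow_le π q
    have h4 : (π q : ℕ) ≤ (minAbove π q : ℕ) := le_minAbove π q
    rw [toggleFun_self]
    apply Fin.ext
    simp only [toggleValue, h1, h2, toggleFun_self]
    omega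
  · rw [toggleFun_of_ne p _ h, toggleFun_of_ne p _ h]

/-- The piecewise-linear toggle at `p`, an involution of the set of `P`-partitions of
height `m`. -/
noncomputable def toggle (m : ℕ) (p : P) : Equiv.Perm (PPartition P m) :=
  (toggleFun_involutive p).toPerm

end Toggle

section Rowmotion

variable {P : Type*} [PartialOrder P] [Fintype P]

/-- The list `p₁, p₂, …, pₙ` is a linear extension of `P`: it contains every element exactly
once, and `pᵢ < pⱼ` forces `i < j`. -/
def IsLinearExtensionList (l : List P) : Prop :=
  l.Nodup ∧ (∀ p : P, p ∈ l) ∧ l.Pairwise fun p q => ¬ q < p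

variable (P) in
theorem exists_isLinearExtensionList : ∃ l : List P, IsLinearExtensionList l := by
  classical
  let s : Finset (LinearExtension P) := (Finset.univ : Finset P).map (Equiv.refl P).toEmbedding
  refine ⟨s.sort (· ≤ ·), Finset.sort_nodup s _, fun p => ?_, ?_⟩
  · exact (Finset.mem_sort (α := LinearExtension P) (s := s) (· ≤ ·)).mpr (by
      exact Finset.mem_map.mpr ⟨p, Finset.mem_univ p, rfl⟩)
  · have h1 : (s.sort (· ≤ ·)).Pairwise (fun p q : LinearExtension P => p ≤ q) :=
      Finset.pairwise_sort s _
    have h2 : (s.sort (· ≤ ·)).Nodup := Finset.sort_nodup s _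
    refine (h1.and h2).imp ?_
    rintro a b ⟨hab, hne⟩ hlt
    have : (b : LinearExtension P) ≤ a :=
      (toLinearExtension : P →o LinearExtension P).monotone (le_of_lt (show @LT.lt P _ b a from hlt))
    exact hne (le_antisymm hab this)

/-- The composition `τ_{p₁} · τ_{p₂} ⋯ τ_{pₙ}` of the toggles along the list `p₁, …, pₙ`;
as usual for compositions of maps, the last one is applied first. -/
noncomputable def toggleProd (m : ℕ) (l : List P) : Equiv.Perm (PPartition P m) :=
  (l.map (toggle m)).prod

variable (P) in
/-- Rowmotion on the `P`-partitions of height `m`: the composition of all the toggles along any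
linear extension of `P`. The choice does not matter, see `rowmotion_eq_toggleProd`. -/
noncomputable def rowmotion (m : ℕ) : Equiv.Perm (PPartition P m) :=
  toggleProd m (exists_isLinearExtensionList P).choose

theorem toggleProd_of_notMem {m : ℕ} {l : List P} {q : P} (h : q ∉ l) (π : PPartition P m) :
    toggleProd m l π q = π q := by
  induction l with
  | nil => rfl
  | cons p l ih =>
    rw [List.mem_cons, not_or] at h
    have : toggleProd m (p :: l) π = toggleFun p (toggleProd m l π) := rfl
    rw [this, toggleFun_of_ne _ _ h.1, ih h.2]

theorem toggleProd_apply {m : ℕ} {l : List P} (hl : IsLinearExtensionList l)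
    (π : PPartition P m) (p : P) :
    ((toggleProd m l π p : Fin (m + 1)) : ℕ) =
      (minAbove (toggleProd m l π) p : ℕ) + (maxBelow π p : ℕ) - (π p : ℕ) := by
  obtain ⟨hnd, hmem, hpw⟩ := hl
  obtain ⟨l₁, l₂, rfl⟩ := List.append_of_mem (hmem p)
  have happ : toggleProd m (l₁ ++ p :: l₂) π =
      toggleProd m l₁ (toggleFun p (toggleProd m l₂ π)) := by
    simp only [toggleProd, List.map_append, List.map_cons, List.prod_append, List.prod_cons]
    rfl
  rw [List.pairwise_append, List.pairwise_cons] at hpw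
  obtain ⟨-, ⟨hp2, -⟩, hp1⟩ := hpw
  rw [List.nodup_append', List.nodup_cons] at hnd
  obtain ⟨-, ⟨hpl2, -⟩, hdisj⟩ := hnd
  have hpl1 : p ∉ l₁ := fun h => hdisj h (by simp)
  have hup : minAbove (toggleProd m l₂ π) p =
      minAbove (toggleProd m (l₁ ++ p :: l₂) π) p := by
    refine minAbove_congr fun r hr => ?_
    have : r ∉ l₁ := fun h => hp1 r h p (by simp) hr.lt
    rw [happ, toggleProd_of_notMem this, toggleFun_of_ne _ _ hr.lt.ne']
  have hdown : maxBelow (toggleProd m l₂ π) p = maxBelow π p := by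
    refine maxBelow_congr fun r hr => ?_
    exact toggleProd_of_notMem (fun h => hp2 r h hr.lt) π
  rw [← hup, ← hdown, ← toggleProd_of_notMem hpl2 π, happ, toggleProd_of_notMem hpl1,
    toggleFun_self]
  rfl

/-- Rowmotion does not depend on the linear extension. -/
theorem rowmotion_eq_toggleProd (m : ℕ) {l : List P} (hl : IsLinearExtensionList l) :
    rowmotion P m = toggleProd m l := by
  ext π p : 3
  induction p using (wellFounded_gt (α := P)).induction with
  | _ p ih =>
    have h1 := toggleProd_apply (exists_isLinearExtensionList P).choose_spec π p
    have h2 := toggleProd_apply hl π p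
    have h3 : minAbove (rowmotion P m π) p = minAbove (toggleProd m l π) p :=
      minAbove_congr fun r hr => ih r hr.lt
    apply Fin.ext
    rw [h2, ← h3]
    exact h1

end Rowmotion

/-- The rectangle poset `a × b`: the positions `(i, j)` of an `a × b` array (numbered from `0`),
with `(i, j) ≤ (i', j')` if and only if `i' ≤ i` and `j' ≤ j`. -/
abbrev Rectangle (a b : ℕ) : Type := (Fin a × Fin b)ᵒᵈ

/-- Plane partitions in an `a × b × m` box: `a × b` arrays with entries in `{0, …, m}` that weakly
decrease along rows and columns, as the order of `Rectangle` is the backwards one. -/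
abbrev PlanePartition (a b m : ℕ) : Type := PPartition (Rectangle a b) m

/-- Transposition of `n × n` plane partitions: `Tr(π)_{i,j} = π_{j,i}`. -/
def transposePP {n m : ℕ} (π : PlanePartition n n m) : PlanePartition n n m where
  toFun := fun p => π (OrderDual.toDual (OrderDual.ofDual p).swap)
  monotone' := fun _ _ h => π.monotone <| OrderDual.toDual_le_toDual.mpr <|
    Prod.swap_le_swap.mpr (OrderDual.ofDual_le_ofDual.mpr h)

/-- The corner triangle of size `n`, the root poset of type `Bₙ`, as a subposet of the
rectangle `2n × 2n`: the positions `(i, j)` with `i ≤ j` and `i + j ≤ 2n` when rows and columns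
are numbered from `1`, that is `i ≤ j` and `(i + 1) + (j + 1) ≤ 2n` when they are numbered
from `0`. -/
abbrev CornerTriangle (n : ℕ) : Type :=
  {p : Rectangle (2 * n) (2 * n) //
    ((OrderDual.ofDual p).1 : ℕ) ≤ ((OrderDual.ofDual p).2 : ℕ) ∧
    (((OrderDual.ofDual p).1 : ℕ) + 1) + (((OrderDual.ofDual p).2 : ℕ) + 1) ≤ 2 * n}

/-!
The lift of `π : PPartition (CornerTriangle n) M` to the square is constant, equal to `M`, on the
antidiagonal `i + j = 2 * n + 1`; above it, it is `M` plus the symmetric extension of `π`; and at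
the antipode of a cell `p` at distance `k` above the antidiagonal it is `M - (Row ^ k π) p`. A
direct check of the toggle relations, cell by cell, shows that lifting commutes with rowmotion
(`liftSquare_rowmotion`), and restriction to the triangle undoes it.

What remains is that the lifts are exactly the symmetric plane partitions fixed by `Row ^ (2 * n)`.
Both inclusions follow from reciprocity on the `N × N` square (`entry_reciprocity`), in which rows
and columns are numbered from `1`: the value of `Row ^ (i + j - 1) σ` at `(N + 1 - i, N + 1 - j)`
and the value of `σ` at `(i, j)` add up to the height. Applied to a lift, it says that
`Row ^ (2 * n)` is the identity on the triangle. Applied to a symmetric `σ` fixed by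
`Row ^ (2 * n)`, it says that `σ` equals `M` on the antidiagonal and that the part of `σ` below the
antidiagonal is determined by the part above.

Reciprocity is proved for birational rowmotion with positive real labels, where sums can be
cancelled, and is then tropicalized: starting from the labels `T ^ σ`, the labels of the orbit grow
like `T` to the powers given by piecewise-linear rowmotion as `T → ∞` (`HasExponents.step`). In the
birational setting, a label is the sum of the weights of the lattice paths from the bottom of the
rectangle, where a path is weighted by the product of the ratios `downSlack`, and an inverse label
is a similar sum over the paths to the top for the ratios `upSlack`; moreover `upSlack` at time
`t + 1` is `downSlack` at time `t`. Sums over paths that cross the rectangle from the first to the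
last column are the same for `downSlack` and, one row lower, for `upSlack`
(`IsPosLabelling.pathSum_shift`). Moving a path from the cell `(i, 1)` to the top corner down row by
row, until it starts at the bottom corner, gives reciprocity for the first column, and the toggle
relations propagate it to the other columns (`IsBirOrbit.reciprocity`).
-/

/-! ### Weighted path sums -/

/-- The sum, over all lattice paths with unit steps up or to the right from `(i, j)` to `(r, c)`,
of the product of the weights `A` of the visited cells (both ends included). Cells are numbered
from `1`; the sum vanishes if `r = 0` or `c = 0`. -/
def pathSum (A : ℕ → ℕ → ℝ) (i j : ℕ) : ℕ → ℕ → ℝ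
  | 0, _ => 0
  | _ + 1, 0 => 0
  | r + 1, c + 1 => A (r + 1) (c + 1) *
      ((if r + 1 = i ∧ c + 1 = j then 1 else 0) + pathSum A i j r (c + 1) + pathSum A i j (r + 1) c)
termination_by r c => r + c

section PathSum

variable {A : ℕ → ℕ → ℝ}

@[simp] theorem pathSum_zero_left (i j c : ℕ) : pathSum A i j 0 c = 0 := by
  rw [pathSum]

@[simp] theorem pathSum_zero_right (i j r : ℕ) : pathSum A i j r 0 = 0 := by
  cases r <;> rw [pathSum]

theorem pathSum_succ_succ (i j r c : ℕ) : pathSum A i j (r + 1) (c + 1) = A (r + 1) (c + 1) *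
    ((if r + 1 = i ∧ c + 1 = j then 1 else 0) + pathSum A i j r (c + 1) +
      pathSum A i j (r + 1) c) := by
  rw [pathSum]

theorem pathSum_eq_zero {i j r c : ℕ} (h : r < i ∨ c < j) : pathSum A i j r c = 0 := by
  induction r generalizing c with
  | zero => simp
  | succ r ihr =>
    induction c with
    | zero => simp
    | succ c ihc =>
      rw [pathSum_succ_succ, ihr (by omega), ihc (by omega), if_neg (by omega)]
      simp

theorem pathSum_congr {A' : ℕ → ℕ → ℝ} {p q : ℕ}
    (h : ∀ r c, 1 ≤ r → r ≤ p → 1 ≤ c → c ≤ q → A r c = A' r c) (i j : ℕ) {r c : ℕ}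
    (hr : r ≤ p) (hc : c ≤ q) : pathSum A i j r c = pathSum A' i j r c := by
  induction r generalizing c with
  | zero => simp
  | succ r ihr =>
    induction c with
    | zero => simp
    | succ c ihc =>
      rw [pathSum_succ_succ, pathSum_succ_succ, ihr (by omega) hc, ihc (by omega),
        h _ _ (by omega) hr (by omega) hc]

theorem pathSum_nonneg {p q : ℕ} (h : ∀ r c, 1 ≤ r → r ≤ p → 1 ≤ c → c ≤ q → 0 < A r c)
    (i j : ℕ) {r c : ℕ} (hr : r ≤ p) (hc : c ≤ q) : 0 ≤ pathSum A i j r c := by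
  induction r generalizing c with
  | zero => simp
  | succ r ihr =>
    induction c with
    | zero => simp
    | succ c ihc =>
      rw [pathSum_succ_succ]
      have h1 := h (r + 1) (c + 1) (by omega) hr (by omega) hc
      have h2 := ihr (by omega) hc
      have h3 := ihc (by omega)
      split_ifs <;> positivity

theorem pathSum_pos {p q : ℕ} (h : ∀ r c, 1 ≤ r → r ≤ p → 1 ≤ c → c ≤ q → 0 < A r c)
    {i j : ℕ} (hi : 1 ≤ i) (hj : 1 ≤ j) {r c : ℕ} (hir : i ≤ r) (hjc : j ≤ c)
    (hr : r ≤ p) (hc : c ≤ q) : 0 < pathSum A i j r c := by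
  induction r generalizing c with
  | zero => omega
  | succ r ihr =>
    induction c with
    | zero => omega
    | succ c ihc =>
      rw [pathSum_succ_succ]
      have h1 := h (r + 1) (c + 1) (by omega) hr (by omega) hc
      have h2 := pathSum_nonneg h i j (r := r) (c := c + 1) (by omega) hc
      have h3 := pathSum_nonneg h i j (r := r + 1) (c := c) hr (by omega)
      by_cases hs : r + 1 = i ∧ c + 1 = j
      · rw [if_pos hs]
        positivity
      · rw [if_neg hs]
        rcases (show i ≤ r ∨ j ≤ c by omega) with h4 | h4
        · have := ihr h4 hjc (by omega) hc
          positivity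
        · have := ihc h4 (by omega)
          positivity

/-- The recursion for `pathSum` obtained by splitting off the first cell of a path. -/
theorem pathSum_eq_source {i j : ℕ} (hi : 1 ≤ i) (hj : 1 ≤ j) (r c : ℕ) :
    pathSum A i j r c = A i j *
      ((if r = i ∧ c = j then 1 else 0) + pathSum A (i + 1) j r c + pathSum A i (j + 1) r c) := by
  induction r generalizing c with
  | zero => simp [show ¬ (0 = i) by omega]
  | succ r ihr =>
    induction c with
    | zero => simp [show ¬ (0 = j) by omega]
    | succ c ihc =>
      rw [pathSum_succ_succ, ihr, ihc, pathSum_succ_succ, pathSum_succ_succ]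
      have e1 : (r + 1 = i + 1 ∧ c + 1 = j) = (r = i ∧ c + 1 = j) := by simp
      have e2 : (r + 1 = i ∧ c + 1 = j + 1) = (r + 1 = i ∧ c = j) := by simp
      simp only [e1, e2]
      by_cases hs : r + 1 = i ∧ c + 1 = j
      · obtain ⟨rfl, rfl⟩ := hs
        ring
      · rw [if_neg hs]
        ring

end PathSum

/-! ### Birational rowmotion on a rectangle over the positive reals -/

/-- The sum of the labels of the cells covered by `(i, j)`, where a bottom element with label `1`
is adjoined below the cell `(1, 1)`. Labels are meant to vanish outside the rectangle. -/
noncomputable def birBelow (x : ℕ → ℕ → ℝ) (i j : ℕ) : ℝ :=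
  (if i = 1 ∧ j = 1 then 1 else 0) + x (i - 1) j + x i (j - 1)

/-- The sum of the inverse labels of the cells covering `(i, j)`, where a top element with label
`b` is adjoined above the cell `(p, q)`. Labels are meant to vanish outside the rectangle; as
`0⁻¹ = 0`, the cells there do not contribute. -/
noncomputable def birAbove (p q : ℕ) (b : ℝ) (x : ℕ → ℕ → ℝ) (i j : ℕ) : ℝ :=
  (if i = p ∧ j = q then b⁻¹ else 0) + (x (i + 1) j)⁻¹ + (x i (j + 1))⁻¹

/-- A labelling of the cells `(i, j)`, `1 ≤ i ≤ p`, `1 ≤ j ≤ q`, by positive reals, extended by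
`0` to all of `ℕ × ℕ`. -/
structure IsPosLabelling (p q : ℕ) (x : ℕ → ℕ → ℝ) : Prop where
  pos : ∀ i j, 1 ≤ i → i ≤ p → 1 ≤ j → j ≤ q → 0 < x i j
  zero : ∀ i j, ¬ (1 ≤ i ∧ i ≤ p ∧ 1 ≤ j ∧ j ≤ q) → x i j = 0

/-- The ratio of a label to the sum of the labels below it. -/
noncomputable def downSlack (x : ℕ → ℕ → ℝ) (i j : ℕ) : ℝ := x i j / birBelow x i j

/-- The ratio of the parallel sum of the labels above a cell to its label. -/
noncomputable def upSlack (p q : ℕ) (b : ℝ) (x : ℕ → ℕ → ℝ) (i j : ℕ) : ℝ :=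
  (x i j * birAbove p q b x i j)⁻¹

/-- An orbit of birational rowmotion on the `p × q` rectangle with top label `b`. -/
structure IsBirOrbit (p q : ℕ) (b : ℝ) (x : ℕ → ℕ → ℕ → ℝ) : Prop where
  labelling : ∀ t, IsPosLabelling p q (x t)
  rule : ∀ t i j, 1 ≤ i → i ≤ p → 1 ≤ j → j ≤ q →
    x (t + 1) i j * x t i j * birAbove p q b (x (t + 1)) i j = birBelow (x t) i j

section Birational

variable {p q : ℕ} {b : ℝ}

theorem IsPosLabelling.nonneg {x : ℕ → ℕ → ℝ} (hx : IsPosLabelling p q x) (i j : ℕ) :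
    0 ≤ x i j := by
  by_cases h : 1 ≤ i ∧ i ≤ p ∧ 1 ≤ j ∧ j ≤ q
  · exact (hx.pos i j h.1 h.2.1 h.2.2.1 h.2.2.2).le
  · exact (hx.zero i j h).ge

theorem IsPosLabelling.below_pos {x : ℕ → ℕ → ℝ} (hx : IsPosLabelling p q x) {i j : ℕ}
    (hi : 1 ≤ i) (hip : i ≤ p) (hj : 1 ≤ j) (hjq : j ≤ q) : 0 < birBelow x i j := by
  unfold birBelow
  have h1 := hx.nonneg (i - 1) j
  have h2 := hx.nonneg i (j - 1)
  by_cases h : i = 1 ∧ j = 1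
  · rw [if_pos h]
    positivity
  · rw [if_neg h]
    rcases (show 2 ≤ i ∨ 2 ≤ j by omega) with h3 | h3
    · have := hx.pos (i - 1) j (by omega) (by omega) hj hjq
      positivity
    · have := hx.pos i (j - 1) hi hip (by omega) (by omega)
      positivity

theorem IsPosLabelling.above_pos {x : ℕ → ℕ → ℝ} (hx : IsPosLabelling p q x) (hb : 0 < b)
    {i j : ℕ} (hi : 1 ≤ i) (hip : i ≤ p) (hj : 1 ≤ j) (hjq : j ≤ q) :
    0 < birAbove p q b x i j := by
  unfold birAbove
  have h1 := inv_nonneg.mpr (hx.nonneg (i + 1) j)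
  have h2 := inv_nonneg.mpr (hx.nonneg i (j + 1))
  by_cases h : i = p ∧ j = q
  · rw [if_pos h]
    positivity
  · rw [if_neg h]
    rcases (show i < p ∨ j < q by omega) with h3 | h3
    · have := inv_pos.mpr (hx.pos (i + 1) j (by omega) (by omega) hj hjq)
      positivity
    · have := inv_pos.mpr (hx.pos i (j + 1) hi hip (by omega) (by omega))
      positivity

theorem IsPosLabelling.downSlack_pos {x : ℕ → ℕ → ℝ} (hx : IsPosLabelling p q x) (i j : ℕ)
    (hi : 1 ≤ i) (hip : i ≤ p) (hj : 1 ≤ j) (hjq : j ≤ q) : 0 < downSlack x i j :=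
  div_pos (hx.pos i j hi hip hj hjq) (hx.below_pos hi hip hj hjq)

/-- A label is the sum of the weights of the paths from the bottom, for the weight `downSlack`. -/
theorem IsPosLabelling.pathSum_downSlack {x : ℕ → ℕ → ℝ} (hx : IsPosLabelling p q x) {r c : ℕ}
    (hr : r ≤ p) (hc : c ≤ q) : pathSum (downSlack x) 1 1 r c = x r c := by
  induction r generalizing c with
  | zero => rw [pathSum_zero_left, hx.zero _ _ (by omega)]
  | succ r ihr =>
    induction c with
    | zero => rw [pathSum_zero_right, hx.zero _ _ (by omega)]
    | succ c ihc =>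
      rw [pathSum_succ_succ, ihr (by omega) hc, ihc (by omega)]
      have h := (hx.below_pos (i := r + 1) (j := c + 1) (by omega) hr (by omega) hc).ne'
      change downSlack x (r + 1) (c + 1) * birBelow x (r + 1) (c + 1) = _
      rw [downSlack, div_mul_cancel₀ _ h]

/-- An inverse label is, up to the factor `b`, the sum of the weights of the paths to the top, for
the weight `upSlack`. -/
theorem IsPosLabelling.pathSum_upSlack {x : ℕ → ℕ → ℝ} (hx : IsPosLabelling p q x) (hb : 0 < b)
    {i j : ℕ} (hi : 1 ≤ i) (hj : 1 ≤ j) :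
    pathSum (upSlack p q b x) i j p q = b * (x i j)⁻¹ := by
  induction h : (p + 1 - i) + (q + 1 - j) using Nat.strong_induction_on generalizing i j with
  | _ k ih =>
    subst h
    by_cases hr : i ≤ p ∧ j ≤ q
    · obtain ⟨hip, hjq⟩ := hr
      rw [pathSum_eq_source hi hj, ih _ (by omega) (by omega) hj rfl,
        ih _ (by omega) hi (by omega) rfl]
      have h1 := (hx.above_pos hb hi hip hj hjq).ne'
      have h2 := (hx.pos i j hi hip hj hjq).ne'
      have h3 : (if p = i ∧ q = j then (1 : ℝ) else 0) + b * (x (i + 1) j)⁻¹ +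
          b * (x i (j + 1))⁻¹ = b * birAbove p q b x i j := by
        unfold birAbove
        by_cases h : i = p ∧ j = q
        · rw [if_pos h, if_pos (by omega)]
          field_simp
        · rw [if_neg h, if_neg (by omega)]
          ring
      rw [h3, upSlack]
      field_simp
    · rw [pathSum_eq_zero (by omega), hx.zero _ _ (by omega)]
      simp

/-- The weights of paths crossing the rectangle from its first to its last column do not change
when the paths are shifted down by one row and `downSlack` is replaced by `upSlack`. With
`φ = pathSum (downSlack x) (k + 1) 1 / x`, the recursion for `pathSum` says that the value of `φ`
at a cell is an average of its values at the two cells below; this turns the weighted row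
differences of `φ` into a solution of the recursion of the shifted path sum. -/
theorem IsPosLabelling.pathSum_shift {x : ℕ → ℕ → ℝ} (hx : IsPosLabelling p q x) {k r : ℕ}
    (hk : 1 ≤ k) (hq : 1 ≤ q) (hr : r + 1 ≤ p) :
    pathSum (downSlack x) (k + 1) 1 (r + 1) q = pathSum (upSlack p q b x) k 1 r q := by
  set F := pathSum (downSlack x) (k + 1) 1 with hF
  set G := pathSum (upSlack p q b x) k 1 with hG
  obtain ⟨φ, hφ⟩ : ∃ φ : ℕ → ℕ → ℝ, ∀ r c, φ r c = F r c / x r c := ⟨_, fun _ _ => rfl⟩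
  -- `x * φ = F`, also outside the rectangle, where all the terms vanish
  have hFφ : ∀ r c, r ≤ p → c ≤ q → F r c = x r c * φ r c := by
    intro r c hr hc
    by_cases h : 1 ≤ r ∧ 1 ≤ c
    · have := (hx.pos r c h.1 hr h.2 hc).ne'
      rw [hφ]
      field_simp
    · rw [hx.zero r c (by omega), zero_mul]
      rcases (show r = 0 ∨ c = 0 by omega) with rfl | rfl
      · exact pathSum_zero_left _ _ _
      · exact pathSum_zero_right _ _ _
  have hrow : ∀ c, F 1 c = 0 := fun c => pathSum_eq_zero (by omega)
  have havg : ∀ r c, r + 1 ≤ p → c + 1 ≤ q → ¬ (r = 0 ∧ c = 0) →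
      φ (r + 1) (c + 1) * (x r (c + 1) + x (r + 1) c) =
        (if r = k ∧ c = 0 then 1 else 0) + x r (c + 1) * φ r (c + 1) +
          x (r + 1) c * φ (r + 1) c := by
    intro r c hr hc h0
    have h1 := hx.pos (r + 1) (c + 1) (by omega) hr (by omega) hc
    have h2 := hx.below_pos (i := r + 1) (j := c + 1) (by omega) hr (by omega) hc
    have h3 : birBelow x (r + 1) (c + 1) = x r (c + 1) + x (r + 1) c := by
      simp [birBelow, h0]
    have h4 : F (r + 1) (c + 1) = _ := pathSum_succ_succ (A := downSlack x) (k + 1) 1 r c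
    rw [← hF, downSlack, hFφ r (c + 1) (by omega) hc, hFφ (r + 1) c hr (by omega), h3] at h4
    rw [h3] at h2
    rw [hφ, h4]
    have h2' := h2.ne'
    simp only [Nat.add_right_cancel_iff, Nat.add_eq_right]
    field_simp
  -- the first column, where the source of the shifted paths shows up
  have hH0 : ∀ r, 1 ≤ r → r + 1 ≤ p →
      x r 1 * (φ (r + 1) 1 - φ r 1) = if r = k then 1 else 0 := by
    intro r hr hrp
    have h := havg r 0 hrp hq (by omega)
    rw [hx.zero (r + 1) 0 (by omega)] at h
    simp only [and_true, zero_add, add_zero, zero_mul] at h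
    linarith
  have hup : ∀ r c, 1 ≤ r → r + 1 ≤ p → 1 ≤ c → c + 1 ≤ q →
      x r c * upSlack p q b x r c = x r (c + 1) * x (r + 1) c / (x r (c + 1) + x (r + 1) c) := by
    intro r c h1 h2 h3 h4
    have e1 := hx.pos r c (by omega) (by omega) (by omega) (by omega)
    have e2 := hx.pos (r + 1) c (by omega) (by omega) (by omega) (by omega)
    have e3 := hx.pos r (c + 1) (by omega) (by omega) (by omega) (by omega)
    rw [upSlack, birAbove, if_neg (by omega)]
    field_simp
    ring
  have hGH : ∀ r c, r + 1 ≤ p → c + 1 ≤ q →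
      G r c + (if 1 ≤ r ∧ r = k ∧ c = 0 then 1 else 0) =
        x r (c + 1) * (φ (r + 1) (c + 1) - φ r (c + 1)) := by
    intro r c hr hc
    induction r generalizing c with
    | zero =>
      rw [hx.zero 0 (c + 1) (by omega), hG, pathSum_zero_left, if_neg (by omega)]
      simp
    | succ r ihr =>
      induction c with
      | zero =>
        rw [hG, pathSum_zero_right, hH0 (r + 1) (by omega) hr]
        simp
      | succ c ihc =>
        have h1 := ihr (c + 1) (by omega) hc
        have h2 := ihc (by omega)
        rw [if_neg (by omega), add_zero] at h1
        have h3 : G (r + 1) (c + 1) = _ := pathSum_succ_succ (A := upSlack p q b x) k 1 r c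
        have e1 := hx.pos (r + 1) (c + 1) (by omega) (by omega) (by omega) (by omega)
        have e2 := hx.pos (r + 2) (c + 1) (by omega) (by omega) (by omega) (by omega)
        have e3 := hx.pos (r + 1) (c + 2) (by omega) (by omega) (by omega) (by omega)
        have h4 := havg (r + 1) (c + 1) hr hc (by omega)
        have h5 := havg r (c + 1) (by omega) hc (by omega)
        rw [if_neg (by omega), zero_add] at h4 h5
        rw [← hG, h1] at h3
        have h6 : (if r + 1 = k ∧ c + 1 = 1 then (1 : ℝ) else 0) + G (r + 1) c =
            x (r + 1) (c + 1) * (φ (r + 2) (c + 1) - φ (r + 1) (c + 1)) := by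
          rw [← h2, add_comm]
          simp
        have h7 := hup (r + 1) (c + 1) (by omega) hr (by omega) hc
        rw [if_neg (by omega), add_zero]
        have h8 : G (r + 1) (c + 1) = upSlack p q b x (r + 1) (c + 1) *
            (x (r + 1) (c + 1) * (φ (r + 2) (c + 1) - φ (r + 1) (c + 2))) := by
          rw [h3]
          congr 1
          linear_combination h6 + h5
        have h9 : x (r + 1) (c + 1 + 1) + x (r + 1 + 1) (c + 1) ≠ 0 := by positivity
        rw [h8, ← mul_assoc, mul_comm (upSlack _ _ _ _ _ _), h7, div_mul_eq_mul_div,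
          div_eq_iff h9]
        linear_combination (-x (r + 1) (c + 2)) * h4
  -- the last column
  obtain ⟨c, rfl⟩ : ∃ c, q = c + 1 := ⟨q - 1, by omega⟩
  induction r with
  | zero => rw [hrow, hG, pathSum_zero_left]
  | succ r ihr =>
    have h1 : G (r + 1) (c + 1) = _ := pathSum_succ_succ (A := upSlack p (c + 1) b x) k 1 r c
    have h2 := hGH (r + 1) c (by omega) le_rfl
    have e1 := hx.pos (r + 1) (c + 1) (by omega) (by omega) (by omega) (by omega)
    have e2 := hx.pos (r + 2) (c + 1) (by omega) (by omega) (by omega) (by omega)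
    rw [← hG, ← ihr (by omega), hFφ (r + 1) (c + 1) (by omega) le_rfl] at h1
    have h3 : (if r + 1 = k ∧ c + 1 = 1 then (1 : ℝ) else 0) + x (r + 1) (c + 1) *
        φ (r + 1) (c + 1) + G (r + 1) c = x (r + 1) (c + 1) * φ (r + 2) (c + 1) := by
      simp only [Nat.le_add_left, true_and] at h2
      simp only [Nat.add_eq_right]
      linear_combination h2
    rw [h1, h3, hFφ _ _ hr le_rfl, upSlack, birAbove, if_neg (by omega),
      hx.zero (r + 1) (c + 1 + 1) (by omega)]
    field_simp
    simp

theorem IsBirOrbit.upSlack_succ {x : ℕ → ℕ → ℕ → ℝ} (hx : IsBirOrbit p q b x) (t i j : ℕ)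
    (hi : 1 ≤ i) (hip : i ≤ p) (hj : 1 ≤ j) (hjq : j ≤ q) :
    upSlack p q b (x (t + 1)) i j = downSlack (x t) i j := by
  have h := hx.rule t i j hi hip hj hjq
  have h1 := ((hx.labelling t).below_pos hi hip hj hjq).ne'
  have h2 := ((hx.labelling t).pos i j hi hip hj hjq).ne'
  rw [upSlack, downSlack, eq_div_iff h1, ← h]
  have h3 : x (t + 1) i j * birAbove p q b (x (t + 1)) i j ≠ 0 := by
    intro h0
    apply h1
    rw [← h]
    linear_combination (x t i j) * h0
  rw [mul_right_comm, inv_mul_cancel_left₀ h3]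

/-- Reciprocity for the cells of the first column. -/
theorem IsBirOrbit.reciprocity_edge {x : ℕ → ℕ → ℕ → ℝ} (hx : IsBirOrbit p q b x) (hb : 0 < b)
    (t : ℕ) {i : ℕ} (hi : 1 ≤ i) (hip : i ≤ p) (hq : 1 ≤ q) :
    x (t + i) i 1 * x t (p + 1 - i) q = b := by
  have key : ∀ s, s < i →
      pathSum (downSlack (x (t + s))) (s + 1) 1 (p + 1 + s - i) q = x t (p + 1 - i) q := by
    intro s
    induction s with
    | zero => exact fun _ => (hx.labelling t).pathSum_downSlack (by omega) le_rfl
    | succ s ih =>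
      intro hs
      rw [← ih (by omega), show p + 1 + (s + 1) - i = p + 1 + s - i + 1 by omega,
        (hx.labelling _).pathSum_shift (b := b) (by omega) hq (by omega)]
      exact pathSum_congr (p := p) (q := q) (hx.upSlack_succ (t + s)) _ _ (by omega) le_rfl
  have h1 := key (i - 1) (by omega)
  have h2 := (hx.labelling (t + i)).pathSum_upSlack hb hi (le_refl 1)
  rw [show t + i = t + (i - 1) + 1 by omega] at h2 ⊢
  rw [pathSum_congr (hx.upSlack_succ (t + (i - 1))) _ _ le_rfl le_rfl] at h2
  rw [show i - 1 + 1 = i by omega, show p + 1 + (i - 1) - i = p by omega, h2] at h1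
  rw [← h1]
  have := ((hx.labelling (t + (i - 1) + 1)).pos i 1 hi hip le_rfl hq).ne'
  field_simp

/-- Reciprocity: antipodal labels at suitably shifted times multiply to `b`. The toggle relations
at a cell and at its antipode propagate this from one column to the next. -/
theorem IsBirOrbit.reciprocity {x : ℕ → ℕ → ℕ → ℝ} (hx : IsBirOrbit p q b x) (hb : 0 < b)
    {i j : ℕ} (hi : 1 ≤ i) (hip : i ≤ p) (hj : 1 ≤ j) (hjq : j ≤ q) (t : ℕ) :
    x (t + i + j - 1) i j * x t (p + 1 - i) (q + 1 - j) = b := by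
  induction j using Nat.strong_induction_on generalizing i t with
  | _ j ih =>
    rcases (show j = 1 ∨ 2 ≤ j by omega) with rfl | h2
    · exact hx.reciprocity_edge hb t hi hip hjq
    obtain ⟨j, rfl⟩ : ∃ j', j = j' + 1 := ⟨j - 1, by omega⟩
    -- `(i, j)` and its antipode; their times are `s` and `t`
    obtain ⟨s, hs⟩ : ∃ s, s = t + i + j - 1 := ⟨_, rfl⟩
    have r0 := hx.rule s i j hi hip (by omega) (by omega)
    have r1 := hx.rule t (p + 1 - i) (q + 1 - j) (by omega) (by omega) (by omega) (by omega)
    have c0 := ih j (by omega) hi hip (by omega) (by omega) t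
    have c1 := ih j (by omega) hi hip (by omega) (by omega) (t + 1)
    rw [show t + 1 + i + j - 1 = s + 1 by omega] at c1
    rw [← hs] at c0
    have p0 := (hx.labelling s).pos i j hi hip (by omega) (by omega)
    have p1 := (hx.labelling (s + 1)).pos i j hi hip (by omega) (by omega)
    have hbelow : birBelow (x s) i j =
        b * birAbove p q b (x (t + 1)) (p + 1 - i) (q + 1 - j) := by
      have e1 : x s (i - 1) j = b * (x (t + 1) (p + 1 - i + 1) (q + 1 - j))⁻¹ := by
        rcases (show i = 1 ∨ 2 ≤ i by omega) with rfl | h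
        · rw [(hx.labelling _).zero _ _ (by omega), (hx.labelling _).zero _ _ (by omega)]
          simp
        · have := ih j (by omega) (i := i - 1) (by omega) (by omega) (by omega) (by omega) (t + 1)
          rw [show t + 1 + (i - 1) + j - 1 = s by omega,
            show p + 1 - (i - 1) = p + 1 - i + 1 by omega] at this
          have h0 := ((hx.labelling (t + 1)).pos (p + 1 - i + 1) (q + 1 - j) (by omega) (by omega)
            (by omega) (by omega)).ne'
          field_simp
          linarith
      have e2 : x s i (j - 1) = b * (x (t + 1) (p + 1 - i) (q + 1 - j + 1))⁻¹ := by
        rcases (show j = 1 ∨ 2 ≤ j by omega) with rfl | h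
        · rw [(hx.labelling _).zero _ _ (by omega), (hx.labelling _).zero _ _ (by omega)]
          simp
        · have := ih (j - 1) (by omega) hi hip (by omega) (by omega) (t + 1)
          rw [show t + 1 + i + (j - 1) - 1 = s by omega,
            show q + 1 - (j - 1) = q + 1 - j + 1 by omega] at this
          have h0 := ((hx.labelling (t + 1)).pos (p + 1 - i) (q + 1 - j + 1) (by omega) (by omega)
            (by omega) (by omega)).ne'
          field_simp
          linarith
      have e3 : (if i = 1 ∧ j = 1 then (1 : ℝ) else 0) =
          b * (if p + 1 - i = p ∧ q + 1 - j = q then b⁻¹ else 0) := by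
        by_cases h : i = 1 ∧ j = 1
        · rw [if_pos h, if_pos (by omega), mul_inv_cancel₀ hb.ne']
        · rw [if_neg h, if_neg (by omega), mul_zero]
      rw [birBelow, birAbove, e1, e2, e3]
      ring
    have hsum : b * birAbove p q b (x (s + 1)) i j =
        birBelow (x t) (p + 1 - i) (q + 1 - j) := by
      have h0 : b * (b * birAbove p q b (x (s + 1)) i j) =
          b * birBelow (x t) (p + 1 - i) (q + 1 - j) := by
        have e := r0.trans hbelow
        rw [← r1]
        calc b * (b * birAbove p q b (x (s + 1)) i j)
            = (x (s + 1) i j * x (t + 1) (p + 1 - i) (q + 1 - j)) *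
              ((x s i j * x t (p + 1 - i) (q + 1 - j)) * birAbove p q b (x (s + 1)) i j) := by
              rw [c0, c1]
          _ = (x (t + 1) (p + 1 - i) (q + 1 - j) * x t (p + 1 - i) (q + 1 - j)) *
              (x (s + 1) i j * x s i j * birAbove p q b (x (s + 1)) i j) := by ring
          _ = _ := by rw [e]; ring
      exact mul_left_cancel₀ hb.ne' h0
    rw [birAbove, birBelow, if_neg (by omega), if_neg (by omega), zero_add, zero_add,
      mul_add] at hsum
    have e1 : b * (x (s + 1) (i + 1) j)⁻¹ = x t (p + 1 - i - 1) (q + 1 - j) := by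
      rcases (show i = p ∨ i + 1 ≤ p by omega) with rfl | h
      · rw [(hx.labelling _).zero _ _ (by omega), (hx.labelling _).zero _ _ (by omega)]
        simp
      · have := ih j (by omega) (i := i + 1) (by omega) h (by omega) (by omega) t
        rw [show t + (i + 1) + j - 1 = s + 1 by omega,
          show p + 1 - (i + 1) = p + 1 - i - 1 by omega] at this
        have h0 := ((hx.labelling (s + 1)).pos (i + 1) j (by omega) (by omega)
            (by omega) (by omega)).ne'
        field_simp
        linarith
    rw [e1, add_right_inj, show q + 1 - j - 1 = q + 1 - (j + 1) by omega] at hsum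
    rw [← hsum, show t + i + (j + 1) - 1 = s + 1 by omega]
    have h0 := ((hx.labelling (s + 1)).pos i (j + 1) (by omega) (by omega)
            (by omega) (by omega)).ne'
    field_simp

end Birational

/-- One step of birational rowmotion: the labels are given by path sums from each cell to the
top. -/
noncomputable def birStep (p q : ℕ) (b : ℝ) (x : ℕ → ℕ → ℝ) (i j : ℕ) : ℝ :=
  if 1 ≤ i ∧ 1 ≤ j then b * (pathSum (downSlack x) i j p q)⁻¹ else 0

/-- The forward orbit of a labelling under birational rowmotion. -/
noncomputable def birOrbit (p q : ℕ) (b : ℝ) (x : ℕ → ℕ → ℝ) (t : ℕ) : ℕ → ℕ → ℝ :=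
  (birStep p q b)^[t] x

theorem IsPosLabelling.step {p q : ℕ} {b : ℝ} {x : ℕ → ℕ → ℝ} (hx : IsPosLabelling p q x)
    (hb : 0 < b) : IsPosLabelling p q (birStep p q b x) where
  pos i j hi hip hj hjq := by
    have := pathSum_pos hx.downSlack_pos hi hj hip hjq le_rfl le_rfl
    rw [birStep, if_pos ⟨hi, hj⟩]
    positivity
  zero i j h := by
    rw [birStep]
    split_ifs with h1
    · rw [pathSum_eq_zero (by omega)]
      simp
    · rfl

theorem IsPosLabelling.step_rule {p q : ℕ} {b : ℝ} {x : ℕ → ℕ → ℝ}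
    (hx : IsPosLabelling p q x) (hb : 0 < b) {i j : ℕ} (hi : 1 ≤ i) (hip : i ≤ p) (hj : 1 ≤ j)
    (hjq : j ≤ q) :
    birStep p q b x i j * x i j * birAbove p q b (birStep p q b x) i j =
      birBelow x i j := by
  have h0 := pathSum_pos hx.downSlack_pos hi hj hip hjq le_rfl le_rfl
  have h1 := pathSum_eq_source (A := downSlack x) hi hj p q
  have h2 : b * birAbove p q b (birStep p q b x) i j =
      (if p = i ∧ q = j then 1 else 0) + pathSum (downSlack x) (i + 1) j p q +
        pathSum (downSlack x) i (j + 1) p q := by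
    have e0 : (if p = i ∧ q = j then (1 : ℝ) else 0) =
        b * (if i = p ∧ j = q then b⁻¹ else 0) := by
      by_cases h : i = p ∧ j = q
      · rw [if_pos h, if_pos (by omega), mul_inv_cancel₀ hb.ne']
      · rw [if_neg h, if_neg (by omega), mul_zero]
    have e1 : birStep p q b x (i + 1) j = b * (pathSum (downSlack x) (i + 1) j p q)⁻¹ :=
      if_pos (by omega)
    have e2 : birStep p q b x i (j + 1) = b * (pathSum (downSlack x) i (j + 1) p q)⁻¹ :=
      if_pos (by omega)
    rw [birAbove, e0, e1, e2, mul_inv, mul_inv, inv_inv, inv_inv, mul_add, mul_add,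
      mul_inv_cancel_left₀ hb.ne', mul_inv_cancel_left₀ hb.ne']
  rw [← h2] at h1
  have h3 := (hx.below_pos hi hip hj hjq).ne'
  have h4 := (hx.pos i j hi hip hj hjq).ne'
  rw [downSlack, div_mul_eq_mul_div, eq_div_iff h3] at h1
  have h5 : birStep p q b x i j * pathSum (downSlack x) i j p q = b := by
    rw [birStep, if_pos ⟨hi, hj⟩]
    field_simp
  have h6 : b * (birStep p q b x i j * x i j * birAbove p q b (birStep p q b x) i j)
      = b * birBelow x i j := by
    linear_combination (-birStep p q b x i j) * h1 + birBelow x i j * h5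
  exact mul_left_cancel₀ hb.ne' h6

theorem isBirOrbit_birOrbit {p q : ℕ} {b : ℝ} {x : ℕ → ℕ → ℝ} (hx : IsPosLabelling p q x)
    (hb : 0 < b) : IsBirOrbit p q b (birOrbit p q b x) := by
  have h : ∀ t, IsPosLabelling p q (birOrbit p q b x t) := by
    intro t
    induction t with
    | zero => exact hx
    | succ t ih =>
      rw [birOrbit, Function.iterate_succ_apply']
      exact ih.step hb
  refine ⟨h, fun t i j hi hip hj hjq => ?_⟩
  have h1 : birOrbit p q b x (t + 1) = birStep p q b (birOrbit p q b x t) :=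
    Function.iterate_succ_apply' _ _ _
  rw [h1]
  exact (h t).step_rule hb hi hip hj hjq

/-! ### Rowmotion in terms of the entries of an array -/

section Entries

variable {P : Type*} [PartialOrder P] {m : ℕ}

/-- The functions `r` and `c` embed `P` into `ℕ × ℕ` with the reversed order, as row and column
numbers, and `E π` extends `π` to a weakly decreasing array indexed by `ℕ × ℕ`. The fields `above`
and `below` say that the extension adds no values near `p` other than those of `P`-elements above
or below `p` and the conventional values `m = min ∅` and `0 = max ∅`. Hence the minimum over the
covers of `p` and the maximum over the elements covered by `p` can be read off from the four
neighbours of its cell. -/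
structure IsEntryFunction (r c : P → ℕ) (E : PPartition P m → ℕ → ℕ → ℕ) : Prop where
  le_iff : ∀ p q, p ≤ q ↔ r q ≤ r p ∧ c q ≤ c p
  apply_eq : ∀ π p, (π p : ℕ) = E π (r p) (c p)
  le_height : ∀ π i j, E π i j ≤ m
  anti : ∀ π i i' j j', i ≤ i' → j ≤ j' → E π i' j' ≤ E π i j
  above : ∀ π p i j, i ≤ r p → j ≤ c p → i + j < r p + c p →
    E π i j = m ∨ ∃ q, p < q ∧ (π q : ℕ) = E π i j
  below : ∀ π p i j, r p ≤ i → c p ≤ j → r p + c p < i + j →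
    E π i j = 0 ∨ ∃ q, q < p ∧ (π q : ℕ) = E π i j
  row_pos : ∀ p, 1 ≤ r p
  col_pos : ∀ p, 1 ≤ c p

theorem IsEntryFunction.ext {r c : P → ℕ} {E : PPartition P m → ℕ → ℕ → ℕ}
    (hE : IsEntryFunction r c E) {π σ : PPartition P m}
    (h : ∀ p, E π (r p) (c p) = E σ (r p) (c p)) : π = σ := by
  ext p : 2
  apply Fin.ext
  rw [hE.apply_eq, hE.apply_eq, h]

variable [Fintype P]

theorem le_minAbove_of_forall_lt {π : PPartition P m} {p : P} {v : Fin (m + 1)}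
    (h : ∀ q, p < q → v ≤ π q) : v ≤ minAbove π p := by
  classical
  unfold minAbove
  exact Finset.le_inf fun q hq => h q (Finset.mem_filter.mp hq).2.lt

theorem maxBelow_le_of_forall_lt {π : PPartition P m} {p : P} {v : Fin (m + 1)}
    (h : ∀ q, q < p → π q ≤ v) : maxBelow π p ≤ v := by
  classical
  unfold maxBelow
  exact Finset.sup_le fun q hq => h q (Finset.mem_filter.mp hq).2.lt

theorem val_rowmotion (π : PPartition P m) (p : P) :
    (rowmotion P m π p : ℕ) =
      (minAbove (rowmotion P m π) p : ℕ) + (maxBelow π p : ℕ) - (π p : ℕ) :=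
  toggleProd_apply (exists_isLinearExtensionList P).choose_spec π p

/-- This shows that the subtraction in `val_rowmotion` is not truncated. -/
theorem le_minAbove_rowmotion (π : PPartition P m) (p : P) :
    π p ≤ minAbove (rowmotion P m π) p := by
  induction p using (wellFounded_gt (α := P)).induction with
  | _ p ih =>
    refine le_minAbove_of_forall_lt fun q hq => (le_maxBelow_of_lt π hq).trans ?_
    have h1 := val_rowmotion π q
    have h2 := ih q hq
    rw [Fin.le_def] at h2 ⊢
    omega

theorem rowmotion_apply_add (π : PPartition P m) (p : P) :
    (rowmotion P m π p : ℕ) + (π p : ℕ) =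
      (minAbove (rowmotion P m π) p : ℕ) + (maxBelow π p : ℕ) := by
  have h1 := val_rowmotion π p
  have h2 := le_minAbove_rowmotion π p
  rw [Fin.le_def] at h2
  omega

theorem eq_rowmotion_of_apply_add {π σ : PPartition P m}
    (h : ∀ p, (σ p : ℕ) + (π p : ℕ) = (minAbove σ p : ℕ) + (maxBelow π p : ℕ)) :
    σ = rowmotion P m π := by
  ext p : 2
  induction p using (wellFounded_gt (α := P)).induction with
  | _ p ih =>
    have h1 : minAbove σ p = minAbove (rowmotion P m π) p :=
      minAbove_congr fun r hr => ih r hr.lt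
    have h2 := h p
    have h3 := rowmotion_apply_add π p
    rw [h1] at h2
    apply Fin.ext
    omega

namespace IsEntryFunction

variable {r c : P → ℕ} {E : PPartition P m → ℕ → ℕ → ℕ}

theorem minAbove_eq (hE : IsEntryFunction r c E) (π : PPartition P m) (p : P) :
    (minAbove π p : ℕ) = min (E π (r p - 1) (c p)) (E π (r p) (c p - 1)) := by
  have hr := hE.row_pos p
  have hc := hE.col_pos p
  have key : ∀ i j, i ≤ r p → j ≤ c p → i + j < r p + c p → (minAbove π p : ℕ) ≤ E π i j := by
    intro i j h1 h2 h3
    rcases hE.above π p i j h1 h2 h3 with h | ⟨q, hq, h⟩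
    · rw [h]
      exact Nat.lt_succ_iff.mp (minAbove π p).isLt
    · rw [← h]
      exact minAbove_le_of_lt π hq
  apply le_antisymm
  · exact le_min (key _ _ (by omega) le_rfl (by omega)) (key _ _ le_rfl (by omega) (by omega))
  · have hm : min (E π (r p - 1) (c p)) (E π (r p) (c p - 1)) < m + 1 :=
      Nat.lt_succ_of_le ((min_le_left _ _).trans (hE.le_height _ _ _))
    refine le_minAbove_of_forall_lt (v := ⟨_, hm⟩) fun q hq => ?_
    rw [Fin.le_def, hE.apply_eq π q]
    have h1 := (hE.le_iff p q).mp hq.le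
    have h2 := mt (hE.le_iff q p).mpr hq.not_ge
    rcases (show r q ≤ r p - 1 ∨ c q ≤ c p - 1 by omega) with h3 | h3
    · exact (min_le_left _ _).trans (hE.anti _ _ _ _ _ h3 h1.2)
    · exact (min_le_right _ _).trans (hE.anti _ _ _ _ _ h1.1 h3)

theorem maxBelow_eq (hE : IsEntryFunction r c E) (π : PPartition P m) (p : P) :
    (maxBelow π p : ℕ) = max (E π (r p + 1) (c p)) (E π (r p) (c p + 1)) := by
  have key : ∀ i j, r p ≤ i → c p ≤ j → r p + c p < i + j → E π i j ≤ (maxBelow π p : ℕ) := by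
    intro i j h1 h2 h3
    rcases hE.below π p i j h1 h2 h3 with h | ⟨q, hq, h⟩
    · rw [h]
      exact Nat.zero_le _
    · rw [← h]
      exact le_maxBelow_of_lt π hq
  apply le_antisymm
  · have hm : max (E π (r p + 1) (c p)) (E π (r p) (c p + 1)) < m + 1 :=
      Nat.lt_succ_of_le (max_le (hE.le_height _ _ _) (hE.le_height _ _ _))
    refine maxBelow_le_of_forall_lt (v := ⟨_, hm⟩) fun q hq => ?_
    rw [Fin.le_def, hE.apply_eq π q]
    have h1 := (hE.le_iff q p).mp hq.le
    have h2 := mt (hE.le_iff p q).mpr hq.not_ge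
    rcases (show r p + 1 ≤ r q ∨ c p + 1 ≤ c q by omega) with h3 | h3
    · exact (hE.anti _ _ _ _ _ h3 h1.2).trans (le_max_left _ _)
    · exact (hE.anti _ _ _ _ _ h1.1 h3).trans (le_max_right _ _)
  · exact max_le (key _ _ (by omega) le_rfl (by omega)) (key _ _ le_rfl (by omega) (by omega))

theorem rowmotion_add (hE : IsEntryFunction r c E) (π : PPartition P m) (p : P) :
    E (rowmotion P m π) (r p) (c p) + E π (r p) (c p) =
      min (E (rowmotion P m π) (r p - 1) (c p)) (E (rowmotion P m π) (r p) (c p - 1)) +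
        max (E π (r p + 1) (c p)) (E π (r p) (c p + 1)) := by
  rw [← hE.apply_eq, ← hE.apply_eq, ← hE.minAbove_eq, ← hE.maxBelow_eq, rowmotion_apply_add]

theorem le_rowmotion_above (hE : IsEntryFunction r c E) (π : PPartition P m) (p : P) :
    E π (r p) (c p) ≤
      min (E (rowmotion P m π) (r p - 1) (c p)) (E (rowmotion P m π) (r p) (c p - 1)) := by
  rw [← hE.apply_eq, ← hE.minAbove_eq]
  exact le_minAbove_rowmotion π p

theorem eq_rowmotion (hE : IsEntryFunction r c E) {π σ : PPartition P m}
    (h : ∀ p, E σ (r p) (c p) + E π (r p) (c p) =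
      min (E σ (r p - 1) (c p)) (E σ (r p) (c p - 1)) +
        max (E π (r p + 1) (c p)) (E π (r p) (c p + 1))) : σ = rowmotion P m π := by
  refine eq_rowmotion_of_apply_add fun p => ?_
  rw [hE.apply_eq, hE.apply_eq, hE.minAbove_eq, hE.maxBelow_eq, h]

end IsEntryFunction

end Entries

/-- The entry of a plane partition in row `i` and column `j`, numbered from `1`, extended by the
height `m` to the row and the column with number `0`, and by `0` below and to the right of the
array. -/
def entry {N m : ℕ} (π : PlanePartition N N m) (i j : ℕ) : ℕ :=
  if h : (1 ≤ i ∧ i ≤ N) ∧ (1 ≤ j ∧ j ≤ N) then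
    (π (OrderDual.toDual (⟨i - 1, by omega⟩, ⟨j - 1, by omega⟩)) : ℕ)
  else if i = 0 ∨ j = 0 then m else 0

/-- The value of a `P`-partition of the corner triangle at the cell `(i, j)`, numbered from `1`,
extended symmetrically to the cells with `j < i`, by the height `m` to the row and the column with
number `0`, and by `0` to the cells with `2 * n < i + j`. -/
def triEntry {n m : ℕ} (π : PPartition (CornerTriangle n) m) (i j : ℕ) : ℕ :=
  if h : 1 ≤ i ∧ 1 ≤ j ∧ i + j ≤ 2 * n then
    (π ⟨OrderDual.toDual (⟨min i j - 1, by omega⟩, ⟨max i j - 1, by omega⟩), by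
      simp only [OrderDual.ofDual_toDual]
      omega⟩ : ℕ)
  else if i = 0 ∨ j = 0 then m else 0

theorem isEntryFunction_entry (N m : ℕ) :
    IsEntryFunction (fun p : Rectangle N N => ((OrderDual.ofDual p).1 : ℕ) + 1)
      (fun p => ((OrderDual.ofDual p).2 : ℕ) + 1) (entry (m := m)) where
  le_iff p q := by
    rw [← OrderDual.ofDual_le_ofDual, Prod.le_def, Fin.le_def, Fin.le_def]
    simp
  apply_eq π p := by
    rw [entry, dif_pos (by omega)]
    rfl
  le_height π i j := by
    unfold entry
    split_ifs
    · exact Nat.lt_succ_iff.mp (Fin.isLt _)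
    · exact le_rfl
    · exact Nat.zero_le _
  anti π i i' j j' hi hj := by
    unfold entry
    split_ifs
    any_goals omega
    apply π.monotone
    rw [OrderDual.toDual_le_toDual, Prod.le_def, Fin.le_def, Fin.le_def]
    simp only
    omega
  above π p i j hi hj h := by
    by_cases h0 : i = 0 ∨ j = 0
    · left
      rw [entry, dif_neg (by omega), if_pos h0]
    · right
      refine ⟨OrderDual.toDual (⟨i - 1, by omega⟩, ⟨j - 1, by omega⟩), ?_, ?_⟩
      · rw [lt_iff_le_not_ge, ← OrderDual.ofDual_le_ofDual, ← OrderDual.ofDual_le_ofDual,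
          Prod.le_def, Fin.le_def, Fin.le_def, Prod.le_def, Fin.le_def, Fin.le_def]
        simp only [OrderDual.ofDual_toDual]
        omega
      · rw [entry, dif_pos (by omega)]
  below π p i j hi hj h := by
    by_cases h0 : N < i ∨ N < j
    · left
      rw [entry, dif_neg (by omega), if_neg (by omega)]
    · right
      refine ⟨OrderDual.toDual (⟨i - 1, by omega⟩, ⟨j - 1, by omega⟩), ?_, ?_⟩
      · rw [lt_iff_le_not_ge, ← OrderDual.ofDual_le_ofDual, ← OrderDual.ofDual_le_ofDual,
          Prod.le_def, Fin.le_def, Fin.le_def, Prod.le_def, Fin.le_def, Fin.le_def]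
        simp only [OrderDual.ofDual_toDual]
        omega
      · rw [entry, dif_pos (by omega)]
  row_pos p := by omega
  col_pos p := by omega

theorem isEntryFunction_triEntry (n m : ℕ) :
    IsEntryFunction (fun p : CornerTriangle n => ((OrderDual.ofDual p.1).1 : ℕ) + 1)
      (fun p => ((OrderDual.ofDual p.1).2 : ℕ) + 1) (triEntry (m := m)) where
  le_iff p q := by
    rw [← Subtype.coe_le_coe, ← OrderDual.ofDual_le_ofDual, Prod.le_def, Fin.le_def, Fin.le_def]
    simp
  apply_eq π p := by
    have hp := p.2
    rw [triEntry, dif_pos (by omega)]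
    refine congrArg (fun q => (π q : ℕ)) (Subtype.ext (OrderDual.ofDual_inj.mp ?_))
    refine Prod.ext (Fin.ext ?_) (Fin.ext ?_) <;>
    · simp only [OrderDual.ofDual_toDual]
      omega
  le_height π i j := by
    unfold triEntry
    split_ifs
    · exact Nat.lt_succ_iff.mp (Fin.isLt _)
    · exact le_rfl
    · exact Nat.zero_le _
  anti π i i' j j' hi hj := by
    unfold triEntry
    split_ifs
    any_goals omega
    apply π.monotone
    rw [Subtype.mk_le_mk, OrderDual.toDual_le_toDual, Prod.le_def, Fin.le_def, Fin.le_def]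
    simp only
    omega
  above π p i j hi hj h := by
    have hp := p.2
    by_cases h0 : i = 0 ∨ j = 0
    · left
      rw [triEntry, dif_neg (by omega), if_pos h0]
    · right
      refine ⟨⟨OrderDual.toDual (⟨min i j - 1, by omega⟩, ⟨max i j - 1, by omega⟩), by
        simp only [OrderDual.ofDual_toDual]
        omega⟩, ?_, ?_⟩
      · rw [lt_iff_le_not_ge, ← Subtype.coe_le_coe, ← Subtype.coe_le_coe,
          ← OrderDual.ofDual_le_ofDual, ← OrderDual.ofDual_le_ofDual,
          Prod.le_def, Fin.le_def, Fin.le_def, Prod.le_def, Fin.le_def, Fin.le_def]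
        simp only [OrderDual.ofDual_toDual]
        omega
      · rw [triEntry, dif_pos (by omega)]
  below π p i j hi hj h := by
    have hp := p.2
    by_cases h0 : 2 * n < i + j
    · left
      rw [triEntry, dif_neg (by omega), if_neg (by omega)]
    · right
      refine ⟨⟨OrderDual.toDual (⟨min i j - 1, by omega⟩, ⟨max i j - 1, by omega⟩), by
        simp only [OrderDual.ofDual_toDual]
        omega⟩, ?_, ?_⟩
      · rw [lt_iff_le_not_ge, ← Subtype.coe_le_coe, ← Subtype.coe_le_coe,
          ← OrderDual.ofDual_le_ofDual, ← OrderDual.ofDual_le_ofDual,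
          Prod.le_def, Fin.le_def, Fin.le_def, Prod.le_def, Fin.le_def, Fin.le_def]
        simp only [OrderDual.ofDual_toDual]
        omega
      · rw [triEntry, dif_pos (by omega)]
  row_pos p := by omega
  col_pos p := by omega

/-! ### Tropicalization -/

section Tropicalization

open Filter Asymptotics

section Theta

theorem isTheta_add_of_nonneg {f₁ f₂ g₁ g₂ : ℝ → ℝ} (h₁ : f₁ =Θ[atTop] g₁) (h₂ : f₂ =Θ[atTop] g₂)
    (hf₁ : ∀ᶠ T in atTop, 0 ≤ f₁ T) (hf₂ : ∀ᶠ T in atTop, 0 ≤ f₂ T)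
    (hg₁ : ∀ᶠ T in atTop, 0 ≤ g₁ T) (hg₂ : ∀ᶠ T in atTop, 0 ≤ g₂ T) :
    (fun T => f₁ T + f₂ T) =Θ[atTop] fun T => g₁ T + g₂ T := by
  have key : ∀ {u₁ u₂ v₁ v₂ : ℝ → ℝ}, u₁ =O[atTop] v₁ → u₂ =O[atTop] v₂ →
      (∀ᶠ T in atTop, 0 ≤ v₁ T) → (∀ᶠ T in atTop, 0 ≤ v₂ T) →
      (fun T => u₁ T + u₂ T) =O[atTop] fun T => v₁ T + v₂ T := by
    intro u₁ u₂ v₁ v₂ h1 h2 p1 p2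
    refine IsBigO.add (h1.trans (IsBigO.of_bound 1 ?_)) (h2.trans (IsBigO.of_bound 1 ?_))
    · filter_upwards [p1, p2] with T e1 e2
      rw [Real.norm_of_nonneg e1, Real.norm_of_nonneg (by positivity)]
      linarith
    · filter_upwards [p1, p2] with T e1 e2
      rw [Real.norm_of_nonneg e2, Real.norm_of_nonneg (by positivity)]
      linarith
  exact ⟨key h₁.1 h₂.1 hg₁ hg₂, key h₁.2 h₂.2 hf₁ hf₂⟩

theorem pow_isBigO_pow {a b : ℕ} (h : a ≤ b) :
    (fun T : ℝ => T ^ a) =O[atTop] fun T => T ^ b := by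
  refine IsBigO.of_bound 1 ?_
  filter_upwards [eventually_ge_atTop 1] with T hT
  rw [Real.norm_of_nonneg (by positivity), Real.norm_of_nonneg (by positivity), one_mul]
  exact pow_le_pow_right₀ hT h

theorem isTheta_pow_injective {a b : ℕ}
    (h : (fun T : ℝ => T ^ a) =Θ[atTop] fun T => T ^ b) : a = b := by
  have key : ∀ {a b : ℕ}, ((fun T : ℝ => T ^ a) =O[atTop] fun T => T ^ b) → a ≤ b := by
    intro a b h
    by_contra! hlt
    have h1 : (fun T : ℝ => T ^ b) =o[atTop] fun T => T ^ a := isLittleO_pow_pow_atTop_of_lt hlt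
    refine h1.not_isBigO (Eventually.frequently ?_) h
    filter_upwards [eventually_gt_atTop 0] with T hT
    positivity
  exact le_antisymm (key h.1) (key h.2)

theorem eventually_pow_nonneg (a : ℕ) : ∀ᶠ T : ℝ in atTop, 0 ≤ T ^ a := by
  filter_upwards [eventually_ge_atTop 0] with T hT
  positivity

theorem isTheta_pow_add_pow (a b : ℕ) :
    (fun T : ℝ => T ^ a + T ^ b) =Θ[atTop] fun T => T ^ max a b := by
  constructor
  · exact (pow_isBigO_pow (le_max_left a b)).add (pow_isBigO_pow (le_max_right a b))
  · refine IsBigO.of_bound 1 ?_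
    filter_upwards [eventually_ge_atTop 0] with T hT
    rw [Real.norm_of_nonneg (by positivity), Real.norm_of_nonneg (by positivity), one_mul]
    rcases max_choice a b with h | h <;> rw [h]
    · linarith [pow_nonneg hT b]
    · linarith [pow_nonneg hT a]

theorem isTheta_inv_pow_add_inv_pow (a b : ℕ) :
    (fun T : ℝ => (T ^ a)⁻¹ + (T ^ b)⁻¹) =Θ[atTop] fun T => (T ^ min a b)⁻¹ := by
  have h : (fun T : ℝ => (T ^ a)⁻¹ + (T ^ b)⁻¹) =ᶠ[atTop]
      fun T => (T ^ a + T ^ b) * (T ^ (a + b))⁻¹ := by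
    filter_upwards [eventually_gt_atTop 0] with T hT
    field_simp
    ring
  refine h.trans_isTheta (((isTheta_pow_add_pow a b).mul (isTheta_refl _ _)).trans
    (EventuallyEq.isTheta ?_))
  filter_upwards [eventually_gt_atTop 0] with T hT
  rw [← max_add_min, pow_add]
  field_simp

end Theta

/-- The array of exponents of `π`, in the coordinates for which the bottom of the rectangle is
`(1, 1)`. -/
def expo {N m : ℕ} (π : PlanePartition N N m) (a b : ℕ) : ℕ := entry π (N + 1 - a) (N + 1 - b)

/-- The labelling of the rectangle with labels `T ^ π`. -/
noncomputable def powLabelling {N m : ℕ} (π : PlanePartition N N m) (T : ℝ) (a b : ℕ) : ℝ :=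
  if 1 ≤ a ∧ a ≤ N ∧ 1 ≤ b ∧ b ≤ N then T ^ expo π a b else 0

section Tropical

variable {N m : ℕ}

theorem isPosLabelling_powLabelling (π : PlanePartition N N m) {T : ℝ} (hT : 0 < T) :
    IsPosLabelling N N (powLabelling π T) where
  pos i j h1 h2 h3 h4 := by
    rw [powLabelling, if_pos ⟨h1, h2, h3, h4⟩]
    positivity
  zero i j h := by rw [powLabelling, if_neg h]

theorem entry_eq_height (π : PlanePartition N N m) {i j : ℕ} (h : i = 0 ∨ j = 0) :
    entry π i j = m := by
  rw [entry, dif_neg (by omega), if_pos h]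

theorem entry_eq_zero (π : PlanePartition N N m) {i j : ℕ} (hi : 1 ≤ i) (hj : 1 ≤ j)
    (h : N < i ∨ N < j) : entry π i j = 0 := by
  rw [entry, dif_neg (by omega), if_neg (by omega)]

theorem entry_rowmotion (π : PlanePartition N N m) {i j : ℕ} (hi : 1 ≤ i) (hiN : i ≤ N)
    (hj : 1 ≤ j) (hjN : j ≤ N) :
    entry (rowmotion _ m π) i j + entry π i j =
      min (entry (rowmotion _ m π) (i - 1) j) (entry (rowmotion _ m π) i (j - 1)) +
        max (entry π (i + 1) j) (entry π i (j + 1)) := by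
  have h := (isEntryFunction_entry N m).rowmotion_add π
    (OrderDual.toDual (⟨i - 1, by omega⟩, ⟨j - 1, by omega⟩))
  simp only [OrderDual.ofDual_toDual, Nat.sub_add_cancel hi, Nat.sub_add_cancel hj] at h
  exact h

theorem expo_rowmotion (π : PlanePartition N N m) {a b : ℕ} (ha : 1 ≤ a) (haN : a ≤ N)
    (hb : 1 ≤ b) (hbN : b ≤ N) :
    expo (rowmotion _ m π) a b + expo π a b =
      min (expo (rowmotion _ m π) (a + 1) b) (expo (rowmotion _ m π) a (b + 1)) +
        max (expo π (a - 1) b) (expo π a (b - 1)) := by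
  have h := entry_rowmotion π (i := N + 1 - a) (j := N + 1 - b) (by omega) (by omega) (by omega)
    (by omega)
  simp only [expo]
  rw [h, show N + 1 - (a - 1) = N + 1 - a + 1 by omega,
    show N + 1 - (b - 1) = N + 1 - b + 1 by omega, show N + 1 - (a + 1) = N + 1 - a - 1 by omega,
    show N + 1 - (b + 1) = N + 1 - b - 1 by omega]

/-- The labels `x T` of the square are positive for large `T`, and they have the order of growth of
`T ^ π` as `T` tends to infinity. -/
structure HasExponents (x : ℝ → ℕ → ℕ → ℝ) (π : PlanePartition N N m) : Prop where
  labelling : ∀ᶠ T in atTop, IsPosLabelling N N (x T)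
  isTheta : ∀ a b, 1 ≤ a → a ≤ N → 1 ≤ b → b ≤ N →
    (fun T => x T a b) =Θ[atTop] fun T => T ^ expo π a b

theorem HasExponents.isTheta_birBelow {x : ℝ → ℕ → ℕ → ℝ} {π : PlanePartition N N m}
    (hx : HasExponents x π) {a b : ℕ} (ha : 1 ≤ a) (haN : a ≤ N) (hb : 1 ≤ b) (hbN : b ≤ N) :
    (fun T => birBelow (x T) a b) =Θ[atTop]
      fun T => T ^ max (expo π (a - 1) b) (expo π a (b - 1)) := by
  have e1 : a = 1 → expo π (a - 1) b = 0 := fun h =>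
    entry_eq_zero π (by omega) (by omega) (by omega)
  have e2 : b = 1 → expo π a (b - 1) = 0 := fun h =>
    entry_eq_zero π (by omega) (by omega) (by omega)
  have hz : ∀ i j, i = 0 ∨ j = 0 → (fun T => x T i j) =ᶠ[atTop] fun _ => 0 := by
    intro i j h
    filter_upwards [hx.labelling] with T hT
    exact hT.zero i j (by omega)
  rcases (show a = 1 ∨ 2 ≤ a by omega) with h1 | h1 <;>
    rcases (show b = 1 ∨ 2 ≤ b by omega) with h2 | h2
  · rw [e1 h1, e2 h2, max_self]
    refine EventuallyEq.isTheta ?_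
    filter_upwards [hz (a - 1) b (by omega), hz a (b - 1) (by omega)] with T h3 h4
    rw [birBelow, if_pos ⟨h1, h2⟩, h3, h4]
    simp
  · rw [e1 h1, Nat.zero_max]
    refine EventuallyEq.trans_isTheta ?_ (hx.isTheta a (b - 1) ha haN (by omega) (by omega))
    filter_upwards [hz (a - 1) b (by omega)] with T h3
    rw [birBelow, if_neg (by omega), h3]
    simp
  · rw [e2 h2, Nat.max_zero]
    refine EventuallyEq.trans_isTheta ?_ (hx.isTheta (a - 1) b (by omega) (by omega) hb hbN)
    filter_upwards [hz a (b - 1) (by omega)] with T h3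
    rw [birBelow, if_neg (by omega), h3]
    simp
  · refine IsTheta.trans ?_ (isTheta_pow_add_pow _ _)
    have h : (fun T => birBelow (x T) a b) = fun T => x T (a - 1) b + x T a (b - 1) := by
      funext T
      rw [birBelow, if_neg (by omega), zero_add]
    rw [h]
    exact isTheta_add_of_nonneg (hx.isTheta _ _ (by omega) (by omega) hb hbN)
      (hx.isTheta _ _ ha haN (by omega) (by omega)) (hx.labelling.mono fun T hT => hT.nonneg _ _)
      (hx.labelling.mono fun T hT => hT.nonneg _ _) (eventually_pow_nonneg _)
      (eventually_pow_nonneg _)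

/-- This needs the growth of the labels of the covering cells only, so that it can be used in an
induction from the top. -/
theorem isTheta_birAbove {x : ℝ → ℕ → ℕ → ℝ} {π : PlanePartition N N m}
    (hx : ∀ᶠ T in atTop, IsPosLabelling N N (x T)) {a b : ℕ} (haN : a ≤ N) (hbN : b ≤ N)
    (h₁ : a + 1 ≤ N → (fun T => x T (a + 1) b) =Θ[atTop] fun T => T ^ expo π (a + 1) b)
    (h₂ : b + 1 ≤ N → (fun T => x T a (b + 1)) =Θ[atTop] fun T => T ^ expo π a (b + 1)) :
    (fun T => birAbove N N (T ^ m) (x T) a b) =Θ[atTop]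
      fun T => (T ^ min (expo π (a + 1) b) (expo π a (b + 1)))⁻¹ := by
  have hle : ∀ i j, expo π i j ≤ m := fun i j => (isEntryFunction_entry N m).le_height _ _ _
  have e1 : a = N → expo π (a + 1) b = m := fun h => entry_eq_height π (by omega)
  have e2 : b = N → expo π a (b + 1) = m := fun h => entry_eq_height π (by omega)
  have hz : ∀ i j, i = N + 1 ∨ j = N + 1 → (fun T => x T i j) =ᶠ[atTop] fun _ => 0 := by
    intro i j h
    filter_upwards [hx] with T hT
    exact hT.zero i j (by omega)
  rcases (show a = N ∨ a + 1 ≤ N by omega) with h1 | h1 <;>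
    rcases (show b = N ∨ b + 1 ≤ N by omega) with h2 | h2
  · rw [e1 h1, e2 h2, min_self]
    refine EventuallyEq.isTheta ?_
    filter_upwards [hz (a + 1) b (by omega), hz a (b + 1) (by omega)] with T h3 h4
    rw [birAbove, if_pos ⟨h1, h2⟩, h3, h4]
    simp
  · rw [e1 h1, min_eq_right (hle _ _)]
    refine EventuallyEq.trans_isTheta ?_ (h₂ h2).inv
    filter_upwards [hz (a + 1) b (by omega)] with T h3
    rw [birAbove, if_neg (by omega), h3]
    simp
  · rw [e2 h2, min_eq_left (hle _ _)]
    refine EventuallyEq.trans_isTheta ?_ (h₁ h1).inv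
    filter_upwards [hz a (b + 1) (by omega)] with T h3
    rw [birAbove, if_neg (by omega), h3]
    simp
  · refine IsTheta.trans ?_ (isTheta_inv_pow_add_inv_pow _ _)
    have h : (fun T => birAbove N N (T ^ m) (x T) a b) =
        fun T => (x T (a + 1) b)⁻¹ + (x T a (b + 1))⁻¹ := by
      funext T
      rw [birAbove, if_neg (by omega), zero_add]
    rw [h]
    exact isTheta_add_of_nonneg (h₁ h1).inv (h₂ h2).inv
      (hx.mono fun T hT => inv_nonneg.mpr (hT.nonneg _ _))
      (hx.mono fun T hT => inv_nonneg.mpr (hT.nonneg _ _))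
      ((eventually_pow_nonneg _).mono fun T hT => inv_nonneg.mpr hT)
      ((eventually_pow_nonneg _).mono fun T hT => inv_nonneg.mpr hT)

/-- Piecewise-linear rowmotion is the tropicalization of birational rowmotion. -/
theorem HasExponents.step {x y : ℝ → ℕ → ℕ → ℝ} {π : PlanePartition N N m}
    (hx : HasExponents x π) (hy : ∀ᶠ T in atTop, IsPosLabelling N N (y T))
    (hxy : ∀ᶠ T in atTop, ∀ a b, 1 ≤ a → a ≤ N → 1 ≤ b → b ≤ N →
      y T a b * x T a b * birAbove N N (T ^ m) (y T) a b = birBelow (x T) a b) :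
    HasExponents y (rowmotion _ m π) := by
  refine ⟨hy, fun a b ha haN hb hbN => ?_⟩
  induction h : (N - a) + (N - b) using Nat.strong_induction_on generalizing a b with
  | _ k ih =>
    subst h
    have habove := isTheta_birAbove (π := rowmotion _ m π) hy haN hbN
      (fun h => ih _ (by omega) (a + 1) b (by omega) h hb hbN rfl)
      (fun h => ih _ (by omega) a (b + 1) ha haN (by omega) h rfl)
    have h1 : (fun T => y T a b) =ᶠ[atTop]
        fun T => birBelow (x T) a b / (x T a b * birAbove N N (T ^ m) (y T) a b) := by
      filter_upwards [hxy, hx.labelling, hy, eventually_gt_atTop 0] with T e1 e2 e3 e4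
      have e5 := e2.pos a b ha haN hb hbN
      have e6 := e3.above_pos (pow_pos e4 m) ha haN hb hbN
      rw [eq_div_iff (by positivity), ← e1 a b ha haN hb hbN]
      ring
    refine h1.trans_isTheta (((hx.isTheta_birBelow ha haN hb hbN).div
      ((hx.isTheta a b ha haN hb hbN).mul habove)).trans (EventuallyEq.isTheta ?_))
    filter_upwards [eventually_gt_atTop 0] with T hT
    have h2 := expo_rowmotion π ha haN hb hbN
    rw [div_eq_iff (by positivity), ← mul_assoc, ← pow_add, h2, pow_add, mul_right_comm,
      mul_inv_cancel₀ (by positivity), one_mul]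

/-- Reciprocity of piecewise-linear rowmotion on the square. -/
theorem entry_reciprocity (π : PlanePartition N N m) {i j : ℕ} (hi : 1 ≤ i) (hiN : i ≤ N)
    (hj : 1 ≤ j) (hjN : j ≤ N) :
    entry ((rowmotion _ m ^ (i + j - 1)) π) (N + 1 - i) (N + 1 - j) + entry π i j = m := by
  have horb : ∀ᶠ T : ℝ in atTop,
      IsBirOrbit N N (T ^ m) (birOrbit N N (T ^ m) (powLabelling π T)) := by
    filter_upwards [eventually_gt_atTop 0] with T hT
    exact isBirOrbit_birOrbit (isPosLabelling_powLabelling π hT) (pow_pos hT m)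
  have hexp : ∀ t, HasExponents (fun T => birOrbit N N (T ^ m) (powLabelling π T) t)
      ((rowmotion _ m ^ t) π) := by
    intro t
    induction t with
    | zero =>
      refine ⟨horb.mono fun T hT => hT.labelling 0, fun a b h1 h2 h3 h4 => ?_⟩
      refine EventuallyEq.isTheta (Eventually.of_forall fun T => ?_)
      exact if_pos ⟨h1, h2, h3, h4⟩
    | succ t ih =>
      rw [pow_succ', Equiv.Perm.mul_apply]
      exact ih.step (horb.mono fun T hT => hT.labelling (t + 1))
        (horb.mono fun T hT => hT.rule t)
  have h1 := (hexp (i + j - 1)).isTheta i j hi hiN hj hjN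
  have h2 := (hexp 0).isTheta (N + 1 - i) (N + 1 - j) (by omega) (by omega) (by omega) (by omega)
  have h3 := h1.mul h2
  simp only [← pow_add] at h3
  have h4 : (fun T : ℝ => birOrbit N N (T ^ m) (powLabelling π T) (i + j - 1) i j *
      birOrbit N N (T ^ m) (powLabelling π T) 0 (N + 1 - i) (N + 1 - j)) =ᶠ[atTop]
      fun T => T ^ m := by
    filter_upwards [horb, eventually_gt_atTop 0] with T hT hpos
    have := hT.reciprocity (pow_pos hpos m) hi hiN hj hjN 0
    rwa [show 0 + i + j - 1 = i + j - 1 by omega] at this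
  have h5 := isTheta_pow_injective (h3.symm.trans h4.isTheta)
  refine Eq.trans ?_ h5
  rw [expo, expo, show N + 1 - (N + 1 - i) = i by omega,
    show N + 1 - (N + 1 - j) = j by omega, pow_zero, Equiv.Perm.one_apply]

end Tropical

end Tropicalization

/-! ### Lifting from the corner triangle to the square -/

section Lift

variable {n M : ℕ}

theorem triEntry_comm (π : PPartition (CornerTriangle n) M) (i j : ℕ) :
    triEntry π i j = triEntry π j i := by
  by_cases h : 1 ≤ i ∧ 1 ≤ j ∧ i + j ≤ 2 * n
  · rw [triEntry, triEntry, dif_pos h, dif_pos (by omega)]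
    simp only [min_comm i j, max_comm i j]
  · rw [triEntry, triEntry, dif_neg h, dif_neg (by omega)]
    simp only [or_comm]

theorem triEntry_le (π : PPartition (CornerTriangle n) M) (i j : ℕ) : triEntry π i j ≤ M :=
  (isEntryFunction_triEntry n M).le_height π i j

theorem triEntry_eq_height (π : PPartition (CornerTriangle n) M) {i j : ℕ} (h : i = 0 ∨ j = 0) :
    triEntry π i j = M := by
  rw [triEntry, dif_neg (by omega), if_pos h]

theorem triEntry_eq_zero (π : PPartition (CornerTriangle n) M) {i j : ℕ} (hi : 1 ≤ i)
    (hj : 1 ≤ j) (h : 2 * n < i + j) : triEntry π i j = 0 := by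
  rw [triEntry, dif_neg (by omega), if_neg (by omega)]

theorem triEntry_rowmotion (π : PPartition (CornerTriangle n) M) {i j : ℕ} (hi : 1 ≤ i)
    (hj : 1 ≤ j) (hij : i + j ≤ 2 * n) :
    triEntry (rowmotion _ M π) i j + triEntry π i j =
      min (triEntry (rowmotion _ M π) (i - 1) j) (triEntry (rowmotion _ M π) i (j - 1)) +
        max (triEntry π (i + 1) j) (triEntry π i (j + 1)) := by
  wlog hle : i ≤ j generalizing i j
  · have h := this hj hi (by omega) (by omega)
    rw [triEntry_comm _ i j, triEntry_comm _ i j, triEntry_comm _ i (j - 1),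
      triEntry_comm _ (i - 1) j, triEntry_comm _ i (j + 1), triEntry_comm _ (i + 1) j, h,
      min_comm, max_comm]
  have h := (isEntryFunction_triEntry n M).rowmotion_add π
    ⟨OrderDual.toDual (⟨i - 1, by omega⟩, ⟨j - 1, by omega⟩), by
      simp only [OrderDual.ofDual_toDual]
      omega⟩
  simp only [OrderDual.ofDual_toDual, Nat.sub_add_cancel hi, Nat.sub_add_cancel hj] at h
  exact h

/-- This inequality makes the lift of `π` weakly decreasing below the antidiagonal. -/
theorem triEntry_le_rowmotion (π : PPartition (CornerTriangle n) M) {i j : ℕ} (hi : 1 ≤ i)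
    (hj : 1 ≤ j) : triEntry π i j ≤ triEntry (rowmotion _ M π) (i - 1) j := by
  by_cases hij : i + j ≤ 2 * n
  · rcases le_total i j with hle | hle
    · have h := (isEntryFunction_triEntry n M).le_rowmotion_above π
        ⟨OrderDual.toDual (⟨i - 1, by omega⟩, ⟨j - 1, by omega⟩), by
          simp only [OrderDual.ofDual_toDual]
          omega⟩
      simp only [OrderDual.ofDual_toDual, Nat.sub_add_cancel hi, Nat.sub_add_cancel hj] at h
      exact h.trans (min_le_left _ _)
    · have h := (isEntryFunction_triEntry n M).le_rowmotion_above π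
        ⟨OrderDual.toDual (⟨j - 1, by omega⟩, ⟨i - 1, by omega⟩), by
          simp only [OrderDual.ofDual_toDual]
          omega⟩
      simp only [OrderDual.ofDual_toDual, Nat.sub_add_cancel hi, Nat.sub_add_cancel hj] at h
      rw [triEntry_comm, triEntry_comm _ _ j]
      exact h.trans (min_le_right _ _)
  · rw [triEntry_eq_zero π hi hj (by omega)]
    exact Nat.zero_le _

/-- The array of the lift of `π` to the square. On and above the antidiagonal `i + j = 2 * n + 1`,
where it is constant, it is `M` plus the symmetric extension of `π`; a cell at distance `k` below
the antidiagonal gets the value complementary to that of the lift of `Row ^ k π` at the antipodal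
cell. -/
noncomputable def liftEntry (π : PPartition (CornerTriangle n) M) (i j : ℕ) : ℕ :=
  if i + j ≤ 2 * n + 1 then M + triEntry π i j
  else M - triEntry ((rowmotion _ M ^ (i + j - (2 * n + 1))) π) (2 * n + 1 - i) (2 * n + 1 - j)

theorem liftEntry_of_le (π : PPartition (CornerTriangle n) M) {i j : ℕ}
    (h : i + j ≤ 2 * n + 1) : liftEntry π i j = M + triEntry π i j :=
  if_pos h

theorem liftEntry_of_ge (π : PPartition (CornerTriangle n) M) {i j : ℕ}
    (hi : 1 ≤ i) (hj : 1 ≤ j) (h : 2 * n + 1 ≤ i + j) : liftEntry π i j =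
      M - triEntry ((rowmotion _ M ^ (i + j - (2 * n + 1))) π) (2 * n + 1 - i) (2 * n + 1 - j) := by
  rcases h.eq_or_lt with h | h
  · rw [liftEntry_of_le π h.ge, triEntry_eq_zero π hi hj (by omega),
      triEntry_eq_zero _ (by omega) (by omega) (by omega)]
    rfl
  · exact if_neg (by omega)

theorem liftEntry_comm (π : PPartition (CornerTriangle n) M) (i j : ℕ) :
    liftEntry π i j = liftEntry π j i := by
  rw [liftEntry, liftEntry, add_comm i j, triEntry_comm π i j, triEntry_comm _ (2 * n + 1 - i)]

theorem liftEntry_succ_le (π : PPartition (CornerTriangle n) M) {i j : ℕ} (hi : 1 ≤ i)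
    (hi' : i ≤ 2 * n) (hj : 1 ≤ j) (hj' : j ≤ 2 * n) :
    liftEntry π (i + 1) j ≤ liftEntry π i j := by
  by_cases h : i + 1 + j ≤ 2 * n + 1
  · rw [liftEntry_of_le π h, liftEntry_of_le π (by omega)]
    have := (isEntryFunction_triEntry n M).anti π i (i + 1) j j (by omega) le_rfl
    omega
  · rw [liftEntry_of_ge π (by omega) hj (by omega), liftEntry_of_ge π hi hj (by omega)]
    apply Nat.sub_le_sub_left
    rw [show i + 1 + j - (2 * n + 1) = i + j - (2 * n + 1) + 1 by omega, pow_succ',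
      Equiv.Perm.mul_apply, show 2 * n + 1 - (i + 1) = 2 * n + 1 - i - 1 by omega]
    exact triEntry_le_rowmotion _ (by omega) (by omega)

theorem liftEntry_anti (π : PPartition (CornerTriangle n) M) {i i' j j' : ℕ} (hi : 1 ≤ i)
    (hii : i ≤ i') (hi' : i' ≤ 2 * n) (hj : 1 ≤ j) (hjj : j ≤ j') (hj' : j' ≤ 2 * n) :
    liftEntry π i' j' ≤ liftEntry π i j := by
  have key : ∀ {i i' j : ℕ}, 1 ≤ i → i ≤ i' → i' ≤ 2 * n → 1 ≤ j → j ≤ 2 * n →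
      liftEntry π i' j ≤ liftEntry π i j := by
    intro i i' j h1 h2 h3 h4 h5
    induction i', h2 using Nat.le_induction with
    | base => exact le_rfl
    | succ k hk ih => exact (liftEntry_succ_le π (by omega) (by omega) h4 h5).trans (ih (by omega))
  refine (key hi hii hi' (hj.trans hjj) hj').trans ?_
  rw [liftEntry_comm π i, liftEntry_comm π i]
  exact key hj hjj hj' hi (hii.trans hi')

theorem liftEntry_le (π : PPartition (CornerTriangle n) M) (i j : ℕ) :
    liftEntry π i j ≤ 2 * M := by
  rw [liftEntry]
  have := triEntry_le π i j
  split_ifs <;> omega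

/-- The lift of a `P`-partition of the corner triangle to a plane partition. -/
noncomputable def liftSquare (π : PPartition (CornerTriangle n) M) :
    PlanePartition (2 * n) (2 * n) (2 * M) where
  toFun p := ⟨liftEntry π ((OrderDual.ofDual p).1 + 1) ((OrderDual.ofDual p).2 + 1),
    Nat.lt_succ_of_le (liftEntry_le π _ _)⟩
  monotone' p q h := by
    rw [← OrderDual.ofDual_le_ofDual, Prod.le_def, Fin.le_def, Fin.le_def] at h
    exact liftEntry_anti π (by omega) (by omega) (by omega) (by omega) (by omega) (by omega)

theorem entry_liftSquare (π : PPartition (CornerTriangle n) M) {i j : ℕ} (hi : i ≤ 2 * n + 1)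
    (hj : j ≤ 2 * n + 1) : entry (liftSquare π) i j = liftEntry π i j := by
  by_cases h0 : i = 0 ∨ j = 0
  · rw [entry_eq_height _ h0, liftEntry_of_le π (by omega), triEntry_eq_height π h0, two_mul]
  by_cases h1 : 2 * n < i ∨ 2 * n < j
  · rw [entry_eq_zero _ (by omega) (by omega) h1, liftEntry_of_ge π (by omega) (by omega)
      (by omega), triEntry_eq_height _ (by omega), Nat.sub_self]
  rw [entry, dif_pos (by omega)]
  change liftEntry π (i - 1 + 1) (j - 1 + 1) = _
  rw [Nat.sub_add_cancel (by omega), Nat.sub_add_cancel (by omega)]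

theorem liftSquare_rowmotion (π : PPartition (CornerTriangle n) M) :
    liftSquare (rowmotion _ M π) = rowmotion _ (2 * M) (liftSquare π) := by
  refine (isEntryFunction_entry (2 * n) (2 * M)).eq_rowmotion fun p => ?_
  obtain ⟨i, hi⟩ : ∃ i, i = ((OrderDual.ofDual p).1 : ℕ) + 1 := ⟨_, rfl⟩
  obtain ⟨j, hj⟩ : ∃ j, j = ((OrderDual.ofDual p).2 : ℕ) + 1 := ⟨_, rfl⟩
  have hi1 : 1 ≤ i := by omega
  have hi2 : i ≤ 2 * n := by omega
  have hj1 : 1 ≤ j := by omega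
  have hj2 : j ≤ 2 * n := by omega
  simp only [← hi, ← hj]
  clear hi hj
  rw [entry_liftSquare _ (by omega) (by omega), entry_liftSquare _ (by omega) (by omega),
    entry_liftSquare _ (by omega) (by omega), entry_liftSquare _ (by omega) (by omega),
    entry_liftSquare _ (by omega) (by omega), entry_liftSquare _ (by omega) (by omega)]
  rcases lt_trichotomy (i + j) (2 * n + 1) with h | h | h
  · have hrule := triEntry_rowmotion π hi1 hj1 (by omega)
    rw [liftEntry_of_le _ (by omega), liftEntry_of_le _ (by omega), liftEntry_of_le _ (by omega),
      liftEntry_of_le _ (by omega), liftEntry_of_le _ (by omega), liftEntry_of_le _ (by omega)]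
    omega
  · -- on the antidiagonal, the neighbours above and below are complementary
    rw [liftEntry_of_le _ (by omega), liftEntry_of_le _ (by omega),
      liftEntry_of_le (i := i - 1) _ (by omega), liftEntry_of_le (j := j - 1) _ (by omega),
      liftEntry_of_ge (i := i + 1) _ (by omega) (by omega) (by omega),
      liftEntry_of_ge (j := j + 1) _ (by omega) (by omega) (by omega),
      triEntry_eq_zero _ hi1 hj1 (by omega), triEntry_eq_zero _ hi1 hj1 (by omega),
      show i + 1 + j - (2 * n + 1) = 1 by omega, show i + (j + 1) - (2 * n + 1) = 1 by omega,
      pow_one, show 2 * n + 1 - (i + 1) = j - 1 by omega, show 2 * n + 1 - j = i by omega,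
      show 2 * n + 1 - (j + 1) = i - 1 by omega, show 2 * n + 1 - i = j by omega,
      triEntry_comm _ (j - 1) i, triEntry_comm _ j (i - 1)]
    have h1 := triEntry_le (rowmotion _ M π) (i - 1) j
    have h2 := triEntry_le (rowmotion _ M π) i (j - 1)
    omega
  · obtain ⟨k, hk⟩ : ∃ k, i + j = 2 * n + 1 + (k + 1) := ⟨i + j - (2 * n + 2), by omega⟩
    rw [liftEntry_of_ge (i := i) (j := j) _ (by omega) (by omega) (by omega),
      liftEntry_of_ge (i := i) (j := j) _ (by omega) (by omega) (by omega),
      liftEntry_of_ge (i := i - 1) _ (by omega) (by omega) (by omega),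
      liftEntry_of_ge (j := j - 1) _ (by omega) (by omega) (by omega),
      liftEntry_of_ge (i := i + 1) _ (by omega) (by omega) (by omega),
      liftEntry_of_ge (j := j + 1) _ (by omega) (by omega) (by omega),
      show i + j - (2 * n + 1) = k + 1 by omega, show i - 1 + j - (2 * n + 1) = k by omega,
      show i + (j - 1) - (2 * n + 1) = k by omega, show i + 1 + j - (2 * n + 1) = k + 2 by omega,
      show i + (j + 1) - (2 * n + 1) = k + 2 by omega, ← Equiv.Perm.mul_apply,
      ← Equiv.Perm.mul_apply, ← pow_succ, ← pow_succ,
      show 2 * n + 1 - (i - 1) = 2 * n + 1 - i + 1 by omega,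
      show 2 * n + 1 - (j - 1) = 2 * n + 1 - j + 1 by omega,
      show 2 * n + 1 - (i + 1) = 2 * n + 1 - i - 1 by omega,
      show 2 * n + 1 - (j + 1) = 2 * n + 1 - j - 1 by omega]
    have hrule := triEntry_rowmotion ((rowmotion _ M ^ (k + 1)) π) (i := 2 * n + 1 - i)
      (j := 2 * n + 1 - j) (by omega) (by omega) (by omega)
    rw [← Equiv.Perm.mul_apply, ← pow_succ'] at hrule
    have hle := fun k i j => triEntry_le ((rowmotion _ M ^ k) π) i j
    have h1 := hle (k + 2) (2 * n + 1 - i) (2 * n + 1 - j)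
    have h2 := hle (k + 1) (2 * n + 1 - i) (2 * n + 1 - j)
    have h3 := hle (k + 1) (2 * n + 1 - i + 1) (2 * n + 1 - j)
    have h4 := hle (k + 1) (2 * n + 1 - i) (2 * n + 1 - j + 1)
    have h5 := hle (k + 2) (2 * n + 1 - i - 1) (2 * n + 1 - j)
    have h6 := hle (k + 2) (2 * n + 1 - i) (2 * n + 1 - j - 1)
    simp only [add_assoc, Nat.reduceAdd] at hrule ⊢ h1 h2 h3 h4 h5 h6
    omega

theorem liftSquare_rowmotion_pow (π : PPartition (CornerTriangle n) M) (k : ℕ) :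
    liftSquare ((rowmotion _ M ^ k) π) = (rowmotion _ (2 * M) ^ k) (liftSquare π) := by
  induction k with
  | zero => rfl
  | succ k ih =>
    rw [pow_succ', pow_succ', Equiv.Perm.mul_apply, Equiv.Perm.mul_apply, liftSquare_rowmotion, ih]

/-- Rowmotion of the corner triangle has order dividing `2 * n`: compare the definition of the lift
below the antidiagonal with reciprocity on the square. -/
theorem rowmotion_cornerTriangle_pow (π : PPartition (CornerTriangle n) M) :
    (rowmotion _ M ^ (2 * n)) π = π := by
  refine (isEntryFunction_triEntry n M).ext fun p => ?_
  have hp := p.2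
  obtain ⟨i, hi⟩ : ∃ i, i = ((OrderDual.ofDual p.1).1 : ℕ) + 1 := ⟨_, rfl⟩
  obtain ⟨j, hj⟩ : ∃ j, j = ((OrderDual.ofDual p.1).2 : ℕ) + 1 := ⟨_, rfl⟩
  rw [← hi, ← hj] at hp
  simp only [← hi, ← hj]
  have h := entry_reciprocity (liftSquare π) (i := i) (j := j) (by omega) (by omega) (by omega)
    (by omega)
  rw [← liftSquare_rowmotion_pow, entry_liftSquare _ (by omega) (by omega),
    entry_liftSquare _ (by omega) (by omega), liftEntry_of_le (i := i) (j := j) _ (by omega),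
    liftEntry_of_ge _ (by omega) (by omega) (by omega), ← Equiv.Perm.mul_apply, ← pow_add,
    show 2 * n + 1 - i + (2 * n + 1 - j) - (2 * n + 1) + (i + j - 1) = 2 * n by omega,
    show 2 * n + 1 - (2 * n + 1 - i) = i by omega,
    show 2 * n + 1 - (2 * n + 1 - j) = j by omega] at h
  have h1 := triEntry_le ((rowmotion _ M ^ (2 * n)) π) i j
  omega

theorem entry_transposePP {N m : ℕ} (π : PlanePartition N N m) (i j : ℕ) :
    entry (transposePP π) i j = entry π j i := by
  by_cases h : (1 ≤ i ∧ i ≤ N) ∧ (1 ≤ j ∧ j ≤ N)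
  · rw [entry, entry, dif_pos h, dif_pos h.symm]
    rfl
  · rw [entry, entry, dif_neg h, dif_neg (fun h' => h h'.symm)]
    simp only [or_comm]

theorem transposePP_rowmotion {N m : ℕ} (π : PlanePartition N N m) :
    transposePP (rowmotion _ m π) = rowmotion _ m (transposePP π) := by
  refine (isEntryFunction_entry N m).eq_rowmotion fun p => ?_
  simp only [entry_transposePP]
  rw [entry_rowmotion π (by omega) (by omega) (by omega) (by omega), min_comm, max_comm]

theorem transposePP_liftSquare (π : PPartition (CornerTriangle n) M) :
    transposePP (liftSquare π) = liftSquare π := by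
  refine (isEntryFunction_entry _ _).ext fun p => ?_
  rw [entry_transposePP, entry_liftSquare _ (by omega) (by omega),
    entry_liftSquare _ (by omega) (by omega), liftEntry_comm]

end Lift

/-! ### Restricting from the square to the corner triangle -/

section Restrict

variable {n M : ℕ}

/-- The symmetric plane partitions that are fixed by the power `2 * n` of rowmotion. -/
def IsSymmFixed (σ : PlanePartition (2 * n) (2 * n) (2 * M)) : Prop :=
  transposePP σ = σ ∧ (rowmotion (Rectangle (2 * n) (2 * n)) (2 * M) ^ (2 * n)) σ = σ

/-- The restriction of a plane partition to the corner triangle, with `M` subtracted from all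
values (and values less than `M` replaced by `0`). -/
def restrictTriangle (σ : PlanePartition (2 * n) (2 * n) (2 * M)) :
    PPartition (CornerTriangle n) M where
  toFun p := ⟨(σ p.1 : ℕ) - M, by
    have := (σ p.1).isLt
    omega⟩
  monotone' _ _ h := Nat.sub_le_sub_right (Fin.le_def.mp (σ.monotone h)) M

namespace IsSymmFixed

variable {σ : PlanePartition (2 * n) (2 * n) (2 * M)}

theorem rowmotion (hσ : IsSymmFixed σ) : IsSymmFixed (rowmotion _ (2 * M) σ) := by
  refine ⟨by rw [transposePP_rowmotion, hσ.1], ?_⟩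
  rw [← Equiv.Perm.mul_apply, ← pow_succ, pow_succ', Equiv.Perm.mul_apply, hσ.2]

theorem rowmotion_pow (hσ : IsSymmFixed σ) (k : ℕ) :
    IsSymmFixed ((_root_.rowmotion _ (2 * M) ^ k) σ) := by
  induction k with
  | zero => exact hσ
  | succ k ih =>
    rw [pow_succ', Equiv.Perm.mul_apply]
    exact ih.rowmotion

theorem entry_comm (hσ : IsSymmFixed σ) (i j : ℕ) : entry σ i j = entry σ j i := by
  conv_lhs => rw [← hσ.1, entry_transposePP]

/-- The antidiagonal consists of the cells for which reciprocity shifts the time by `2 * n`, the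
period, and for which the antipode is the mirror image. -/
theorem entry_antidiagonal (hσ : IsSymmFixed σ) {i j : ℕ} (hi : 1 ≤ i) (hj : 1 ≤ j)
    (hij : i + j = 2 * n + 1) : entry σ i j = M := by
  have h := entry_reciprocity σ hi (by omega) hj (by omega)
  rw [show i + j - 1 = 2 * n by omega, hσ.2, show 2 * n + 1 - i = j by omega,
    show 2 * n + 1 - j = i by omega, hσ.entry_comm j i] at h
  omega

theorem le_entry (hσ : IsSymmFixed σ) {i j : ℕ} (hij : i + j ≤ 2 * n + 1) : M ≤ entry σ i j := by
  by_cases h : i = 0 ∨ j = 0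
  · rw [entry_eq_height σ h]
    omega
  · refine (hσ.entry_antidiagonal (i := i) (j := 2 * n + 1 - i) (by omega) (by omega)
      (by omega)).ge.trans ?_
    exact (isEntryFunction_entry _ _).anti σ _ _ _ _ le_rfl (by omega)

theorem triEntry_restrictTriangle (hσ : IsSymmFixed σ) {i j : ℕ} (hij : i + j ≤ 2 * n + 1) :
    triEntry (restrictTriangle σ) i j = entry σ i j - M := by
  by_cases h0 : i = 0 ∨ j = 0
  · rw [triEntry_eq_height _ h0, entry_eq_height _ h0]
    omega
  by_cases h1 : i + j = 2 * n + 1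
  · rw [triEntry_eq_zero _ (by omega) (by omega) (by omega),
      hσ.entry_antidiagonal (by omega) (by omega) h1, Nat.sub_self]
  wlog hle : i ≤ j generalizing i j
  · rw [triEntry_comm, hσ.entry_comm]
    exact this (by omega) (by omega) (by omega) (by omega)
  rw [triEntry, dif_pos (by omega), entry, dif_pos (by omega)]
  simp only [min_eq_left hle, max_eq_right hle]
  rfl

theorem restrictTriangle_rowmotion (hσ : IsSymmFixed σ) :
    restrictTriangle (_root_.rowmotion _ (2 * M) σ) =
      _root_.rowmotion _ M (restrictTriangle σ) := by
  refine (isEntryFunction_triEntry n M).eq_rowmotion fun p => ?_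
  have hp := p.2
  obtain ⟨i, hi⟩ : ∃ i, i = ((OrderDual.ofDual p.1).1 : ℕ) + 1 := ⟨_, rfl⟩
  obtain ⟨j, hj⟩ : ∃ j, j = ((OrderDual.ofDual p.1).2 : ℕ) + 1 := ⟨_, rfl⟩
  rw [← hi, ← hj] at hp
  simp only [← hi, ← hj]
  rw [hσ.rowmotion.triEntry_restrictTriangle (by omega), hσ.triEntry_restrictTriangle (by omega),
    hσ.rowmotion.triEntry_restrictTriangle (by omega),
    hσ.rowmotion.triEntry_restrictTriangle (by omega), hσ.triEntry_restrictTriangle (by omega),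
    hσ.triEntry_restrictTriangle (by omega)]
  have h := entry_rowmotion σ (i := i) (j := j) (by omega) (by omega) (by omega) (by omega)
  have h1 := hσ.le_entry (i := i) (j := j) (by omega)
  have h2 := hσ.le_entry (i := i + 1) (j := j) (by omega)
  have h3 := hσ.le_entry (i := i) (j := j + 1) (by omega)
  have h4 := hσ.rowmotion.le_entry (i := i) (j := j) (by omega)
  have h5 := hσ.rowmotion.le_entry (i := i - 1) (j := j) (by omega)
  have h6 := hσ.rowmotion.le_entry (i := i) (j := j - 1) (by omega)
  omega

theorem restrictTriangle_rowmotion_pow (hσ : IsSymmFixed σ) (k : ℕ) :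
    restrictTriangle ((_root_.rowmotion _ (2 * M) ^ k) σ) =
      (_root_.rowmotion _ M ^ k) (restrictTriangle σ) := by
  induction k with
  | zero => rfl
  | succ k ih =>
    rw [pow_succ', pow_succ', Equiv.Perm.mul_apply, Equiv.Perm.mul_apply,
      (hσ.rowmotion_pow k).restrictTriangle_rowmotion, ih]

/-- Reciprocity recovers the entries below the antidiagonal. -/
theorem liftSquare_restrictTriangle (hσ : IsSymmFixed σ) :
    liftSquare (restrictTriangle σ) = σ := by
  refine (isEntryFunction_entry _ _).ext fun p => ?_
  obtain ⟨i, hi⟩ : ∃ i, i = ((OrderDual.ofDual p).1 : ℕ) + 1 := ⟨_, rfl⟩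
  obtain ⟨j, hj⟩ : ∃ j, j = ((OrderDual.ofDual p).2 : ℕ) + 1 := ⟨_, rfl⟩
  simp only [← hi, ← hj]
  rw [entry_liftSquare _ (by omega) (by omega)]
  rcases le_or_gt (i + j) (2 * n + 1) with h | h
  · rw [liftEntry_of_le _ h, hσ.triEntry_restrictTriangle h]
    have := hσ.le_entry h
    omega
  · have hk := hσ.rowmotion_pow (i + j - (2 * n + 1))
    rw [liftEntry_of_ge _ (by omega) (by omega) (by omega), ← hσ.restrictTriangle_rowmotion_pow,
      hk.triEntry_restrictTriangle (by omega)]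
    have h1 := entry_reciprocity ((_root_.rowmotion _ (2 * M) ^ (i + j - (2 * n + 1))) σ)
      (i := 2 * n + 1 - i) (j := 2 * n + 1 - j) (by omega) (by omega) (by omega) (by omega)
    rw [← Equiv.Perm.mul_apply, ← pow_add,
      show 2 * n + 1 - i + (2 * n + 1 - j) - 1 + (i + j - (2 * n + 1)) = 2 * n by omega, hσ.2,
      show 2 * n + 1 - (2 * n + 1 - i) = i by omega,
      show 2 * n + 1 - (2 * n + 1 - j) = j by omega] at h1
    have h2 := hk.le_entry (i := 2 * n + 1 - i) (j := 2 * n + 1 - j) (by omega)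
    omega

end IsSymmFixed

theorem isSymmFixed_liftSquare (π : PPartition (CornerTriangle n) M) :
    IsSymmFixed (liftSquare π) :=
  ⟨transposePP_liftSquare π, by rw [← liftSquare_rowmotion_pow, rowmotion_cornerTriangle_pow]⟩

theorem restrictTriangle_liftSquare (π : PPartition (CornerTriangle n) M) :
    restrictTriangle (liftSquare π) = π := by
  refine (isEntryFunction_triEntry n M).ext fun p => ?_
  have hp := p.2
  rw [(isSymmFixed_liftSquare π).triEntry_restrictTriangle (by omega),
    entry_liftSquare _ (by omega) (by omega), liftEntry_of_le _ (by omega), Nat.add_sub_cancel_left]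

end Restrict

theorem mainTheorem11 (n M : ℕ) :
    ∃ f : PPartition (CornerTriangle n) M ≃
        {π : PlanePartition (2 * n) (2 * n) (2 * M) //
          transposePP π = π ∧
            (rowmotion (Rectangle (2 * n) (2 * n)) (2 * M) ^ (2 * n)) π = π},
      ∀ π : PPartition (CornerTriangle n) M,
        ((f (rowmotion (CornerTriangle n) M π) :
            {π : PlanePartition (2 * n) (2 * n) (2 * M) //
              transposePP π = π ∧
                (rowmotion (Rectangle (2 * n) (2 * n)) (2 * M) ^ (2 * n)) π = π}) :
            PlanePartition (2 * n) (2 * n) (2 * M)) =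
          rowmotion (Rectangle (2 * n) (2 * n)) (2 * M) (f π) :=
  ⟨{ toFun := fun π => ⟨liftSquare π, isSymmFixed_liftSquare π⟩
     invFun := fun σ => restrictTriangle σ.1
     left_inv := restrictTriangle_liftSquare
     right_inv := fun σ => Subtype.ext (IsSymmFixed.liftSquare_restrictTriangle σ.2) },
    liftSquare_rowmotion⟩
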